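/- **Setting.** Let $x_1,\dots,x_n\in\mathbb R^p$, targets $y_i$, $L(\beta)=\sum_{i=1}^n\ell(y_i,\beta^Tx_i)$ and $R(\beta)=\lambda_1\|\beta\|_1+\frac{\lambda_2}{2}\|\beta\|^2$ with $\lambda_1,\lambda_2\ge 0$, $f=L+R$, where $\ell$ is one of: the squared loss $\ell(y,t)=\frac12(y-t)^2$ ($y\in\mathbb R$), the logistic loss $\log(1+e^{-yt})$ ($y=\pm1$), the probit loss $-\log\Phi(yt)$ ($y=\pm1$, $\Phi$ the standard normal distribution function). Let $\{1,\dots,p\}$ be split into disjoint blocks $S^1,\dots,S^M$, let $\tilde H(\beta)$ have entries $(\nabla^2L(\beta))_{jl}$ if $j,l$ lie in the same block and $0$ otherwise, fix $\nu>0$ and put $H=\mu(\tilde H(\beta)+\nu I)$ for $\mu\ge1$. **d-GLMNET.** From an arbitrary $\beta^0$, iteration $k$ uses $\mu_k\ge1$, $H_k=\mu_k(\tilde H(\beta^k)+\nu I)$ and $q_k(d)=L(\beta^k)+\nabla L(\beta^k)^Td+\frac12d^TH_kd+R(\beta^k+d)$. Each node $m$ computes $d^{k,m}$ supported on $S^m$,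 either as the minimizer of $q_k$ over vectors supported on $S^m$ (*exact* variant), or by starting at $0$ and making one cycle of exact coordinate minimizations of $q_k$ over the features in $S^m$, in any order (*one-cycle* variant). Put $d^k=\sum_md^{k,m}$ and $D_k=\nabla L(\beta^k)^Td^k+\gamma (d^k)^TH_kd^k+R(\beta^k+d^k)-R(\beta^k)$. A step size $\alpha$ is acceptable if $f(\beta^k+\alpha d^k)\le f(\beta^k)+\alpha\sigma D_k$. If $1$ is acceptable, $\alpha_k=1$; otherwise $\alpha_{init}$ is a minimizer of $\alpha\mapsto f(\beta^k+\alpha d^k)$ on $[\delta,1]$ and $\alpha_k$ is the largest acceptable element of $\{\alpha_{init}b^j\}_{j\ge0}$. Then $\beta^{k+1}=\beta^k+\alpha_kd^k$. Here $0<\delta,b,\sigma<1$ and $0\le\gamma<1$ are fixed. **CGD.** The coordinate gradient descent (CGD) method of Tseng and Yun with Armijo line search minimizes $L+R$, with $L$ continuously differentiable and $R$ convex and separable: at iteration $k$, $d^k$ minimizes $q_k$ over the vectors supported on a set $J_k$ of coordinates, where $H_k$ is a symmetric matrix with $e_{min}I\preceq H_k\preceq e_{max}I$ for fixed $e_{min},e_{max}>0$;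 for some $T\ge1$ any $T$ consecutive sets $J_k$ cover all coordinates; $\alpha_k$ is the largest acceptable element of $\{\alpha_{init,k}b^j\}_{j\ge0}$, where the $\alpha_{init,k}$ are bounded and bounded away from $0$; and $\beta^{k+1}=\beta^k+\alpha_kd^k$. **Theorem.** 1. There are $\lambda_{min},\lambda_{max}>0$, depending only on the data, the splitting and $\nu$ (and not on $\beta,\mu,\mu_{max}$), such that $\lambda_{min}I\preceq \mu(\tilde H(\beta)+\nu I)\preceq\mu_{max}\lambda_{max}I$ for all $\beta$ and all $1\le\mu\le\mu_{max}$. Moreover every run of the exact variant of d-GLMNET with $1\le\mu_k\le\mu_{max}$ for all $k$ is a run of CGD with Armijo line search, with the matrices $H_k$, all coordinates updated at each iteration, $e_{min}=\lambda_{min}$ and $e_{max}=\mu_{max}\lambda_{max}$. 2. If $\mu_0=1$ and $\mu_{k+1}=\eta_1\mu_k$ when $\alpha_k<1$, $\mu_{k+1}=\max(1,\mu_k/\eta_2)$ otherwise, with $\eta_1,\eta_2\ge1$, then $1\le\mu_k\le\mu_{max}$ for all $k$, with some $\mu_{max}$ that does not depend on the run (in both variants). 3. If $\lambda_1>0$ or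 $\lambda_2>0$, then $f$ has a minimizer. 4. Consider any run with $1\le\mu_k\le\mu_{max}$ for all $k$, of the exact variant (any $0\le\gamma<1$) or of the one-cycle variant with $\gamma\le\frac12$. Then every cluster point of $(\beta^k)$ is a global minimizer of $f$. If $\beta^*$ is a minimizer of $f$, then $f(\beta^k)\to f(\beta^*)$; and if in addition $L$ is strictly convex, then $f(\beta^k)\to f(\beta^*)$ at least Q-linearly, i.e. for some $c\in[0,1)$ one has $|f(\beta^{k+1})-f(\beta^*)|\le c\,|f(\beta^k)-f(\beta^*)|$ for all large $k$, and $\beta^k\to\beta^*$ at least R-linearly, i.e. $\|\beta^k-\beta^*\|\le Cq^k$ for all $k$, with some $C$ and some $q\in[0,1)$. -/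

import Mathlib

open Filter Topology

noncomputable section

namespace DGLMNET

/-- The weight space `ℝ^p` with the Euclidean norm. -/
abbrev E (p : ℕ) := EuclideanSpace ℝ (Fin p)

/-! ### Losses and the objective -/

/-- The three generalized linear models. -/
inductive Model
  | linear
  | logistic
  | probit

/-- The example-wise loss `ℓ(y, ŷ)`; `cdf (gaussianReal 0 1)` is the standard normal
distribution function. -/
def Model.loss : Model → ℝ → ℝ → ℝ
  | .linear, y, t => (1 / 2) * (y - t) ^ 2
  | .logistic, y, t => Real.log (1 + Real.exp (-(y * t)))
  | .probit, y, t => -Real.log (ProbabilityTheory.cdf (ProbabilityTheory.gaussianReal 0 1) (y * t))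

/-- Real targets for linear regression, labels `±1` for the two classification models. -/
def Model.Admissible : Model → ℝ → Prop
  | .linear, _ => True
  | .logistic, y => y = 1 ∨ y = -1
  | .probit, y => y = 1 ∨ y = -1

/-- A regularized training problem with `n` examples and `p` features, together with the
splitting of the features over `M` nodes: `node j` is the node that holds feature `j`, so
that the `m`-th block is `{j | node j = m}`. -/
structure Problem (n p M : ℕ) where
  model : Model
  x : Fin n → E p
  y : Fin n → ℝ
  y_admissible : ∀ i, model.Admissible (y i)
  node : Fin p → Fin M
  lam1 : ℝ
  lam2 : ℝ
  lam1_nonneg : 0 ≤ lam1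
  lam2_nonneg : 0 ≤ lam2

variable {n p M : ℕ}

/-- The negated log-likelihood `L(β) = ∑ i, ℓ(y_i, βᵀ x_i)`. -/
def Problem.L (P : Problem n p M) (β : E p) : ℝ :=
  ∑ i, P.model.loss (P.y i) (inner ℝ β (P.x i))

/-- The elastic net penalty `R(β) = λ₁ ‖β‖₁ + (λ₂ / 2) ‖β‖²`. -/
def Problem.R (P : Problem n p M) (β : E p) : ℝ :=
  P.lam1 * ∑ j, |β j| + P.lam2 / 2 * ‖β‖ ^ 2

/-- The objective `f = L + R`. -/
def Problem.f (P : Problem n p M) (β : E p) : ℝ := P.L β + P.R β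

/-! ### Quadratic models -/

/-- The Hessian matrix `∇²L(β)` in the standard basis. -/
def hessian (L : E p → ℝ) (β : E p) : Matrix (Fin p) (Fin p) ℝ :=
  Matrix.of fun j l =>
    fderiv ℝ (fderiv ℝ L) β (EuclideanSpace.single j 1) (EuclideanSpace.single l 1)

/-- The quadratic form `dᵀ H d`. -/
def quadForm (H : Matrix (Fin p) (Fin p) ℝ) (d : E p) : ℝ :=
  ∑ j, ∑ l, d j * H j l * d l

/-- The penalized quadratic approximation
`L(β) + ∇L(β)ᵀ d + ½ dᵀ H d + R(β + d)` as a function of `d`. -/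
def penalizedModel (L R : E p → ℝ) (H : Matrix (Fin p) (Fin p) ℝ) (β d : E p) : ℝ :=
  L β + inner ℝ (gradient L β) d + (1 / 2) * quadForm H d + R (β + d)

/-- The predicted decrease `D = ∇L(β)ᵀ d + γ dᵀ H d + R(β + d) - R(β)`. -/
def predictedDecrease (L R : E p → ℝ) (H : Matrix (Fin p) (Fin p) ℝ) (γ : ℝ) (β d : E p) : ℝ :=
  inner ℝ (gradient L β) d + γ * quadForm H d + R (β + d) - R β

/-- The block-diagonal part `H̃(β)` of the Hessian. -/
def Problem.blockHessian (P : Problem n p M) (β : E p) : Matrix (Fin p) (Fin p) ℝ :=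
  Matrix.of fun j l => if P.node j = P.node l then hessian P.L β j l else 0

/-- The matrix `H = μ (H̃(β) + ν I)`. -/
def Problem.modelMatrix (P : Problem n p M) (ν μ : ℝ) (β : E p) : Matrix (Fin p) (Fin p) ℝ :=
  μ • (P.blockHessian β + ν • (1 : Matrix (Fin p) (Fin p) ℝ))

/-- `emin I ⪯ H ⪯ emax I` in the Loewner order (in particular `H` is symmetric). -/
def LoewnerBounded (emin emax : ℝ) (H : Matrix (Fin p) (Fin p) ℝ) : Prop :=
  (H - emin • (1 : Matrix (Fin p) (Fin p) ℝ)).PosSemidef ∧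
    (emax • (1 : Matrix (Fin p) (Fin p) ℝ) - H).PosSemidef

/-! ### Line search -/

/-- Sufficient decrease of `f` at `β` along `d` with step size `α`. -/
def SufficientDecrease (f : E p → ℝ) (σ D : ℝ) (β d : E p) (α : ℝ) : Prop :=
  f (β + α • d) ≤ f β + α * σ * D

/-- `α` is the largest element of `{αinit * b ^ j | j = 0, 1, …}` (with `0 < b < 1`) that
gives sufficient decrease. -/
def ArmijoStep (f : E p → ℝ) (b σ D αinit : ℝ) (β d : E p) (α : ℝ) : Prop :=
  ∃ j : ℕ, α = αinit * b ^ j ∧ SufficientDecrease f σ D β d α ∧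
    ∀ i < j, ¬ SufficientDecrease f σ D β d (αinit * b ^ i)

/-- The fixed parameters of d-GLMNET. -/
structure Params where
  ν : ℝ
  δ : ℝ
  b : ℝ
  σ : ℝ
  γ : ℝ
  ν_pos : 0 < ν
  δ_pos : 0 < δ
  δ_lt_one : δ < 1
  b_pos : 0 < b
  b_lt_one : b < 1
  σ_pos : 0 < σ
  σ_lt_one : σ < 1
  γ_nonneg : 0 ≤ γ
  γ_lt_one : γ < 1

/-- The line search of d-GLMNET: take `α = 1` if it gives sufficient decrease; otherwise
minimize `f` along the segment to get `αinit` and backtrack from there. The minimization is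
over the closed interval `[δ, 1]`, where a minimizer exists; a minimizer over `(δ, 1]` is also
one over `[δ, 1]`. -/
def LineSearch (f : E p → ℝ) (prm : Params) (D : ℝ) (β d : E p) (α : ℝ) : Prop :=
  (SufficientDecrease f prm.σ D β d 1 ∧ α = 1) ∨
    (¬ SufficientDecrease f prm.σ D β d 1 ∧
      ∃ αinit ∈ Set.Icc prm.δ 1,
        IsMinOn (fun t : ℝ => f (β + t • d)) (Set.Icc prm.δ 1) αinit ∧
          ArmijoStep f prm.b prm.σ D αinit β d α)

/-! ### d-GLMNET -/

/-- How a node handles its sub-problem: minimize it exactly, or make one cycle of coordinate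
descent over its features. -/
inductive SubSolver
  | exact
  | oneCycle

/-- `CoordCycle F js v w`: starting from `v` and minimizing `F` exactly with respect to the
coordinates listed in `js`, one after another, one arrives at `w`. -/
inductive CoordCycle (F : E p → ℝ) : List (Fin p) → E p → E p → Prop
  | nil (v : E p) : CoordCycle F [] v v
  | cons (j : Fin p) (js : List (Fin p)) (v w : E p) (τ : ℝ)
      (hmin : ∀ t : ℝ, F (v + EuclideanSpace.single j τ) ≤ F (v + EuclideanSpace.single j t))
      (hrest : CoordCycle F js (v + EuclideanSpace.single j τ) w) :
      CoordCycle F (j :: js) v w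

/-- `v` is the update computed by node `m` when its sub-problem has the objective `F`. In the
one-cycle variant every feature of the node is visited once, in any order, starting at `0`. -/
def NodeUpdate (node : Fin p → Fin M) (F : E p → ℝ) (m : Fin M) : SubSolver → E p → Prop
  | .exact, v => (∀ j, node j ≠ m → v j = 0) ∧
      ∀ w : E p, (∀ j, node j ≠ m → w j = 0) → F v ≤ F w
  | .oneCycle, v => ∃ js : List (Fin p), js.Nodup ∧ (∀ j, j ∈ js ↔ node j = m) ∧
      CoordCycle F js 0 v

/-- An (infinite) run of d-GLMNET with scaling factors `μ k`, iterates `β k`, directions `d k`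
and step sizes `α k`. The starting point `β 0` is arbitrary. -/
structure Problem.IsRun (P : Problem n p M) (prm : Params) (solver : SubSolver)
    (μ : ℕ → ℝ) (β d : ℕ → E p) (α : ℕ → ℝ) : Prop where
  direction : ∀ k, ∃ v : Fin M → E p, d k = ∑ m, v m ∧
    ∀ m, NodeUpdate P.node
      (penalizedModel P.L P.R (P.modelMatrix prm.ν (μ k) (β k)) (β k)) m solver (v m)
  lineSearch : ∀ k, LineSearch P.f prm
    (predictedDecrease P.L P.R (P.modelMatrix prm.ν (μ k) (β k)) prm.γ (β k) (d k))
    (β k) (d k) (α k)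
  update : ∀ k, β (k + 1) = β k + α k • d k

/-- The adaptive rule for `μ`: start with `μ = 1`, multiply by `η₁` after a step with `α < 1`,
and otherwise divide by `η₂`, but not below `1`. -/
def AdaptiveRule (η₁ η₂ : ℝ) (α μ : ℕ → ℝ) : Prop :=
  μ 0 = 1 ∧ ∀ k, μ (k + 1) = if α k < 1 then η₁ * μ k else max 1 (μ k / η₂)

/-! ### Coordinate gradient descent -/

/-- `β` is generated by the coordinate gradient descent method with the Armijo rule for the
minimization of `L + R`: at iteration `k` the coordinates in `J k` are updated, along a
minimizer `d k` of the penalized quadratic model with matrix `H k`. -/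
structure IsCGD (L R : E p → ℝ) (emin emax b σ γ : ℝ) (J : ℕ → Finset (Fin p))
    (H : ℕ → Matrix (Fin p) (Fin p) ℝ) (β d : ℕ → E p) (α : ℕ → ℝ) : Prop where
  smooth : ContDiff ℝ 1 L
  convex : ConvexOn ℝ Set.univ R
  separable : ∃ r : Fin p → ℝ → ℝ, ∀ z : E p, R z = ∑ j, r j (z j)
  emin_pos : 0 < emin
  b_mem : b ∈ Set.Ioo 0 1
  σ_mem : σ ∈ Set.Ioo 0 1
  γ_mem : γ ∈ Set.Ico 0 1
  bounds : ∀ k, LoewnerBounded emin emax (H k)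
  schedule : ∃ T : ℕ, 1 ≤ T ∧ ∀ k j, ∃ i < T, j ∈ J (k + i)
  direction_supp : ∀ k, ∀ j ∉ J k, d k j = 0
  direction_min : ∀ k, ∀ w : E p, (∀ j ∉ J k, w j = 0) →
    penalizedModel L R (H k) (β k) (d k) ≤ penalizedModel L R (H k) (β k) w
  armijo : ∃ lo hi : ℝ, 0 < lo ∧ ∀ k, ∃ αinit ∈ Set.Icc lo hi,
    ArmijoStep (fun z => L z + R z) b σ (predictedDecrease L R (H k) γ (β k) (d k))
      αinit (β k) (d k) (α k)
  update : ∀ k, β (k + 1) = β k + α k • d k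

/-! ### Rates -/

/-- `u` converges to `u'` at least Q-linearly. -/
def QLinear (u : ℕ → ℝ) (u' : ℝ) : Prop :=
  ∃ c ∈ Set.Ico (0 : ℝ) 1, ∀ᶠ k in atTop, |u (k + 1) - u'| ≤ c * |u k - u'|

/-- `z` converges to `z'` at least R-linearly. -/
def RLinear (z : ℕ → E p) (z' : E p) : Prop :=
  ∃ C : ℝ, ∃ q ∈ Set.Ico (0 : ℝ) 1, ∀ k, ‖z k - z'‖ ≤ C * q ^ k

end DGLMNET

end

namespace DGLMNET

variable {n p M : ℕ}

/-! ### Monotone functions vanishing at `-∞` -/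

/-! Each loss is convex with second derivative in `(0, 1]`; for probit this is the Mills ratio
inequality and its relatives, all obtained from vanishing at `-∞` and a signed derivative. Hence
`∇L` is Lipschitz with constant `lip = ∑ ‖x_i‖²`, and the block Hessian, a Gram matrix of
block-restricted examples, lies between `0` and `lip`. This bounds `H`. Since `H` couples no two
blocks, exact block minimizers add up to a minimizer of the whole model, so the exact variant is
CGD. A full step is accepted once `μ` exceeds a fixed threshold, so the adaptive rule cannot push
`μ` to infinity.

For convergence both variants are reduced to one fact (`IsDirection.exists_coordOptimal`): each
`d_j` satisfies the first-order condition of its coordinate problem, with the model linearized at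
some `u` dominated entrywise by `d`. Summing these conditions against any `w` gives `f (β + d) - f w
≤ B ‖d‖ ‖β + d - w‖`. The line search has step sizes bounded below, so `f` drops by a multiple of
`‖d‖²`, and convexity compares `f (β + d)` with the next value of `f`. These estimates form
`IsDescentSeq`, from which the rest follows abstractly.

Convergence of values needs no bounded level sets: `∑ ‖d k‖²` is finite, so the iterates drift at
most like `√k`, and a persistent gap would force `‖d k‖² ≥ const / (k + 1)`, against the divergence
of the harmonic series. Linear rates come from quadratic growth of `f` on sublevel sets: strict
convexity of `L` makes the data matrix injective, and the losses are strongly convex on bounded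
intervals. -/

lemma nonneg_of_deriv_nonneg_of_tendsto_atBot {u u' : ℝ → ℝ} (hd : ∀ t, HasDerivAt u (u' t) t)
    (hn : ∀ t, 0 ≤ u' t) (hl : Tendsto u atBot (𝓝 0)) (t : ℝ) : 0 ≤ u t :=
  (monotone_of_hasDerivAt_nonneg hd hn).le_of_tendsto hl t

lemma pos_of_deriv_pos_of_tendsto_atBot {u u' : ℝ → ℝ} (hd : ∀ t, HasDerivAt u (u' t) t)
    (hn : ∀ t, 0 < u' t) (hl : Tendsto u atBot (𝓝 0)) (t : ℝ) : 0 < u t :=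
  (nonneg_of_deriv_nonneg_of_tendsto_atBot hd (fun s => (hn s).le) hl (t - 1)).trans_lt
    (strictMono_of_hasDerivAt_pos hd hn (by linarith))

/-! ### The standard normal distribution -/

/-- The standard normal density. -/
noncomputable def normalPDF (t : ℝ) : ℝ := ProbabilityTheory.gaussianPDFReal 0 1 t

/-- The standard normal distribution function. -/
noncomputable def normalCDF (t : ℝ) : ℝ :=
  ProbabilityTheory.cdf (ProbabilityTheory.gaussianReal 0 1) t

lemma normalPDF_eq (t : ℝ) : normalPDF t = (√(2 * Real.pi))⁻¹ * Real.exp (-(t ^ 2 / 2)) := by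
  simp [normalPDF, ProbabilityTheory.gaussianPDFReal, neg_div]

lemma normalPDF_pos (t : ℝ) : 0 < normalPDF t :=
  ProbabilityTheory.gaussianPDFReal_pos _ _ _ one_ne_zero

lemma hasDerivAt_normalPDF (t : ℝ) : HasDerivAt normalPDF (-(t * normalPDF t)) t := by
  have h : HasDerivAt (fun t : ℝ => (√(2 * Real.pi))⁻¹ * Real.exp (-(t ^ 2 / 2)))
      ((√(2 * Real.pi))⁻¹ * (Real.exp (-(t ^ 2 / 2)) * (-((2 : ℕ) * t ^ (2 - 1) * 1 / 2)))) t :=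
    ((((hasDerivAt_id t).pow 2).div_const 2).neg.exp).const_mul _
  rw [funext normalPDF_eq]
  refine HasDerivAt.congr_deriv h ?_
  push_cast
  ring

lemma continuous_normalPDF : Continuous normalPDF :=
  continuous_iff_continuousAt.2 fun t => (hasDerivAt_normalPDF t).continuousAt

lemma normalCDF_eq_integral (t : ℝ) : normalCDF t = ∫ s in Set.Iic t, normalPDF s := by
  rw [normalCDF, ProbabilityTheory.cdf_eq_real, MeasureTheory.measureReal_def,
    ProbabilityTheory.gaussianReal_apply_eq_integral 0 one_ne_zero, ENNReal.toReal_ofReal]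
  · rfl
  · exact MeasureTheory.integral_nonneg fun s => ProbabilityTheory.gaussianPDFReal_nonneg _ _ _

lemma hasDerivAt_normalCDF (t : ℝ) : HasDerivAt normalCDF (normalPDF t) t := by
  have hi : MeasureTheory.Integrable normalPDF :=
    ProbabilityTheory.integrable_gaussianPDFReal 0 1
  have h : normalCDF = fun t => normalCDF 0 + ∫ s in (0 : ℝ)..t, normalPDF s := by
    ext t
    rw [normalCDF_eq_integral, normalCDF_eq_integral,
      ← intervalIntegral.integral_Iic_sub_Iic hi.integrableOn hi.integrableOn]
    ring
  rw [h]
  exact (intervalIntegral.integral_hasDerivAt_right hi.intervalIntegrable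
    (continuous_normalPDF.stronglyMeasurableAtFilter _ _)
    continuous_normalPDF.continuousAt).const_add _

lemma tendsto_normalCDF_atBot : Tendsto normalCDF atBot (𝓝 0) :=
  ProbabilityTheory.tendsto_cdf_atBot _

lemma normalCDF_pos (t : ℝ) : 0 < normalCDF t :=
  pos_of_deriv_pos_of_tendsto_atBot hasDerivAt_normalCDF normalPDF_pos tendsto_normalCDF_atBot t

lemma tendsto_sq_mul_normalPDF_atBot : Tendsto (fun t => t ^ 2 * normalPDF t) atBot (𝓝 0) := by
  have h1 : Tendsto (fun t : ℝ => t ^ 2 / 2) atBot atTop :=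
    by
    refine Tendsto.atTop_div_const two_pos ?_
    simpa only [sq, id] using tendsto_id.atBot_mul_atBot₀ (tendsto_id (α := ℝ))
  have h2 := ((Real.tendsto_pow_mul_exp_neg_atTop_nhds_zero 1).comp h1).const_mul
    (2 * (√(2 * Real.pi))⁻¹)
  rw [mul_zero] at h2
  refine h2.congr fun t => ?_
  simp only [Function.comp, normalPDF_eq, pow_one]
  ring

lemma tendsto_normalPDF_atBot : Tendsto normalPDF atBot (𝓝 0) := by
  refine squeeze_zero' (Eventually.of_forall fun t => (normalPDF_pos t).le) ?_
    tendsto_sq_mul_normalPDF_atBot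
  filter_upwards [eventually_le_atBot (-1)] with t ht
  nlinarith [normalPDF_pos t, mul_nonneg (normalPDF_pos t).le (show 0 ≤ t ^ 2 - 1 by nlinarith)]

lemma tendsto_mul_normalPDF_atBot : Tendsto (fun t => t * normalPDF t) atBot (𝓝 0) := by
  refine squeeze_zero_norm' ?_ tendsto_sq_mul_normalPDF_atBot
  filter_upwards [eventually_le_atBot (-1)] with t ht
  rw [Real.norm_eq_abs, abs_mul, abs_of_pos (normalPDF_pos t), abs_of_nonpos (by linarith)]
  exact mul_le_mul_of_nonneg_right (by nlinarith) (normalPDF_pos t).le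

/-- The difference `φ - Φ` vanishes at `-∞` and has derivative `-(s + 1) φ(s) ≥ 0` for `s ≤ -1`.
This transfers the Gaussian decay of `φ` to `Φ`. -/
lemma normalCDF_le_normalPDF {t : ℝ} (ht : t ≤ -1) : normalCDF t ≤ normalPDF t := by
  have hd : ∀ s, HasDerivAt (fun s => normalPDF s - normalCDF s)
      (-(s * normalPDF s) - normalPDF s) s :=
    fun s => (hasDerivAt_normalPDF s).sub (hasDerivAt_normalCDF s)
  have hm : MonotoneOn (fun s => normalPDF s - normalCDF s) (Set.Iic (-1)) := by
    refine monotoneOn_of_deriv_nonneg (convex_Iic _)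
      (fun s _ => (hd s).continuousAt.continuousWithinAt)
      (fun s _ => (hd s).differentiableAt.differentiableWithinAt) fun s hs => ?_
    rw [interior_Iic] at hs
    rw [(hd s).deriv]
    nlinarith [normalPDF_pos s, mul_nonneg (normalPDF_pos s).le
      (show 0 ≤ -s - 1 by linarith [Set.mem_Iio.1 hs])]
  have hl : Tendsto (fun s => normalPDF s - normalCDF s) atBot (𝓝 0) := by
    simpa using tendsto_normalPDF_atBot.sub tendsto_normalCDF_atBot
  have := le_of_tendsto hl (by
    filter_upwards [eventually_le_atBot t] with s hs
    exact hm (Set.mem_Iic.2 (hs.trans ht)) (Set.mem_Iic.2 ht) hs)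
  linarith

lemma tendsto_sq_mul_normalCDF_atBot : Tendsto (fun t => t ^ 2 * normalCDF t) atBot (𝓝 0) := by
  refine squeeze_zero' (Eventually.of_forall fun t => mul_nonneg (sq_nonneg t) (normalCDF_pos t).le)
    ?_ tendsto_sq_mul_normalPDF_atBot
  filter_upwards [eventually_le_atBot (-1)] with t ht
  exact mul_le_mul_of_nonneg_left (normalCDF_le_normalPDF ht) (sq_nonneg t)

lemma tendsto_mul_normalCDF_atBot : Tendsto (fun t => t * normalCDF t) atBot (𝓝 0) := by
  refine squeeze_zero_norm' ?_ tendsto_sq_mul_normalCDF_atBot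
  filter_upwards [eventually_le_atBot (-1)] with t ht
  rw [Real.norm_eq_abs, abs_mul, abs_of_pos (normalCDF_pos t), abs_of_nonpos (by linarith)]
  exact mul_le_mul_of_nonneg_right (by nlinarith) (normalCDF_pos t).le

lemma hasDerivAt_mul_normalCDF_add_normalPDF (t : ℝ) :
    HasDerivAt (fun t => t * normalCDF t + normalPDF t) (normalCDF t) t := by
  refine HasDerivAt.congr_deriv (((hasDerivAt_id t).mul (hasDerivAt_normalCDF t)).add
    (hasDerivAt_normalPDF t)) ?_
  simp

/-- The Mills ratio bound `-t Φ(t) < φ(t)`. -/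
lemma mul_normalCDF_add_normalPDF_pos (t : ℝ) : 0 < t * normalCDF t + normalPDF t :=
  pos_of_deriv_pos_of_tendsto_atBot hasDerivAt_mul_normalCDF_add_normalPDF normalCDF_pos
    (by simpa using tendsto_mul_normalCDF_atBot.add tendsto_normalPDF_atBot) t

/-- The derivative is twice the Mills expression. The quantity is itself a factor of the derivative
in `normalPDF_mul_le_sq_normalCDF`. -/
lemma sq_add_one_mul_normalCDF_add_nonneg (t : ℝ) :
    0 ≤ (t ^ 2 + 1) * normalCDF t + t * normalPDF t := by
  refine nonneg_of_deriv_nonneg_of_tendsto_atBot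
    (u := fun t => (t ^ 2 + 1) * normalCDF t + t * normalPDF t)
    (u' := fun t => 2 * (t * normalCDF t + normalPDF t)) (fun t => ?_)
    (fun t => by linarith [mul_normalCDF_add_normalPDF_pos t]) ?_ t
  · refine HasDerivAt.congr_deriv (((((hasDerivAt_id t).pow 2).add_const 1).mul
      (hasDerivAt_normalCDF t)).add
      ((hasDerivAt_id t).mul (hasDerivAt_normalPDF t))) ?_
    simp
    ring
  · have := (tendsto_sq_mul_normalCDF_atBot.add tendsto_normalCDF_atBot).add
      tendsto_mul_normalPDF_atBot
    simp only [add_zero] at this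
    exact this.congr fun t => by ring

/-- The second derivative of `-log Φ` is at most `1`. -/
lemma normalPDF_mul_le_sq_normalCDF (t : ℝ) :
    normalPDF t * (t * normalCDF t + normalPDF t) ≤ normalCDF t ^ 2 := by
  refine sub_nonneg.1 (nonneg_of_deriv_nonneg_of_tendsto_atBot
    (u := fun t => normalCDF t ^ 2 - normalPDF t * (t * normalCDF t + normalPDF t))
    (u' := fun t => normalPDF t * ((t ^ 2 + 1) * normalCDF t + t * normalPDF t)) (fun t => ?_)
    (fun t => mul_nonneg (normalPDF_pos t).le (sq_add_one_mul_normalCDF_add_nonneg t)) ?_ t)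
  · refine HasDerivAt.congr_deriv (((hasDerivAt_normalCDF t).pow 2).sub
      ((hasDerivAt_normalPDF t).mul (hasDerivAt_mul_normalCDF_add_normalPDF t))) ?_
    simp
    ring
  · simpa using (tendsto_normalCDF_atBot.pow 2).sub
      (tendsto_normalPDF_atBot.mul (tendsto_mul_normalCDF_atBot.add tendsto_normalPDF_atBot))

/-! ### The losses -/

/-- A nonnegative function on `ℝ` with derivative `g` and continuous second derivative
`h` that takes values in `(0, 1]`. -/
structure IsSmoothLoss (l g h : ℝ → ℝ) : Prop where
  deriv : ∀ t, HasDerivAt l (g t) t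
  deriv2 : ∀ t, HasDerivAt g (h t) t
  cont : Continuous h
  pos : ∀ t, 0 < h t
  le_one : ∀ t, h t ≤ 1
  nonneg : ∀ t, 0 ≤ l t

/-- Since `y² = 1`, the chain rule leaves no factor on the second derivative. -/
lemma IsSmoothLoss.comp_mul {l g h : ℝ → ℝ} (hl : IsSmoothLoss l g h) {y : ℝ}
    (hy : y = 1 ∨ y = -1) :
    IsSmoothLoss (fun t => l (y * t)) (fun t => y * g (y * t)) (fun t => h (y * t)) where
  deriv t := by
    have := (hl.deriv (y * t)).comp t ((hasDerivAt_id t).const_mul y)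
    refine HasDerivAt.congr_deriv this ?_
    ring
  deriv2 t := by
    have := ((hl.deriv2 (y * t)).comp t ((hasDerivAt_id t).const_mul y)).const_mul y
    refine HasDerivAt.congr_deriv this ?_
    rcases hy with rfl | rfl <;> simp
  cont := hl.cont.comp (continuous_const.mul continuous_id)
  pos t := hl.pos _
  le_one t := hl.le_one _
  nonneg t := hl.nonneg _

lemma isSmoothLoss_square (y : ℝ) :
    IsSmoothLoss (fun t => (1 / 2) * (y - t) ^ 2) (fun t => t - y) (fun _ => 1) where
  deriv t := by
    refine HasDerivAt.congr_deriv ((((hasDerivAt_id t).const_sub y).pow 2).const_mul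
      (1 / 2 : ℝ)) ?_
    simp
  deriv2 t := (hasDerivAt_id t).sub_const y
  cont := continuous_const
  pos _ := one_pos
  le_one _ := le_rfl
  nonneg t := by positivity

lemma isSmoothLoss_logistic :
    IsSmoothLoss (fun t => Real.log (1 + Real.exp (-t))) (fun t => (1 + Real.exp (-t))⁻¹ - 1)
      (fun t => Real.exp (-t) / (1 + Real.exp (-t)) ^ 2) where
  deriv t := by
    have h : 1 + Real.exp (-t) ≠ 0 := by positivity
    refine HasDerivAt.congr_deriv ((((hasDerivAt_id t).neg.exp).const_add 1).log h) ?_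
    change Real.exp (-t) * -1 / (1 + Real.exp (-t)) = _
    field_simp
    ring
  deriv2 t := by
    have h : 1 + Real.exp (-t) ≠ 0 := by positivity
    refine HasDerivAt.congr_deriv (((((hasDerivAt_id t).neg.exp).const_add 1).inv h).sub_const 1) ?_
    simp
  cont := by
    refine Continuous.div (by fun_prop) (by fun_prop) fun t => ?_
    positivity
  pos t := by positivity
  le_one t := by
    rw [div_le_one (by positivity)]
    nlinarith [Real.exp_pos (-t)]
  nonneg t := Real.log_nonneg (by linarith [Real.exp_pos (-t)])

lemma isSmoothLoss_probit :
    IsSmoothLoss (fun t => -Real.log (normalCDF t)) (fun t => -(normalPDF t / normalCDF t))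
      (fun t => normalPDF t * (t * normalCDF t + normalPDF t) / normalCDF t ^ 2) where
  deriv t := ((hasDerivAt_normalCDF t).log (normalCDF_pos t).ne').neg
  deriv2 t := by
    refine HasDerivAt.congr_deriv (((hasDerivAt_normalPDF t).div (hasDerivAt_normalCDF t)
      (normalCDF_pos t).ne').neg) ?_
    ring
  cont := by
    have : Continuous normalCDF :=
      continuous_iff_continuousAt.2 fun t => (hasDerivAt_normalCDF t).continuousAt
    have := continuous_normalPDF
    exact Continuous.div (by fun_prop) (by fun_prop) fun t => pow_ne_zero 2 (normalCDF_pos t).ne'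
  pos t := div_pos (mul_pos (normalPDF_pos t) (mul_normalCDF_add_normalPDF_pos t))
    (pow_pos (normalCDF_pos t) 2)
  le_one t := (div_le_one (pow_pos (normalCDF_pos t) 2)).2 (normalPDF_mul_le_sq_normalCDF t)
  nonneg t := neg_nonneg.2
    (Real.log_nonpos (normalCDF_pos t).le (ProbabilityTheory.cdf_le_one _ t))

lemma Model.exists_isSmoothLoss (m : Model) {y : ℝ} (hy : m.Admissible y) :
    ∃ g h, IsSmoothLoss (m.loss y) g h := by
  cases m with
  | linear => exact ⟨_, _, isSmoothLoss_square y⟩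
  | logistic => exact ⟨_, _, isSmoothLoss_logistic.comp_mul hy⟩
  | probit => exact ⟨_, _, isSmoothLoss_probit.comp_mul hy⟩

/-! ### Second order bounds on the line -/

lemma le_of_hasDerivAt_nonneg_Icc {u u' : ℝ → ℝ} (hd : ∀ t, HasDerivAt u (u' t) t)
    (hn : ∀ t ∈ Set.Icc (0 : ℝ) 1, 0 ≤ u' t) {s : ℝ} (hs : s ∈ Set.Icc (0 : ℝ) 1) :
    u 0 ≤ u s := by
  refine monotoneOn_of_deriv_nonneg (convex_Icc 0 1)
    (fun t _ => (hd t).continuousAt.continuousWithinAt)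
    (fun t _ => (hd t).differentiableAt.differentiableWithinAt) (fun t ht => ?_)
    (Set.left_mem_Icc.2 zero_le_one) hs hs.1
  rw [(hd t).deriv]
  exact hn t (interior_subset ht)

/-- Monotonicity is used twice along the segment, first for `g`, then for `l`. The curvature bound
is required on the segment only, which permits local strong convexity; applied to `-l` it gives
upper bounds. -/
lemma taylor_two_le {l g h : ℝ → ℝ} (hl : ∀ t, HasDerivAt l (g t) t)
    (hg : ∀ t, HasDerivAt g (h t) t) {a v m : ℝ}
    (hm : ∀ s ∈ Set.Icc (0 : ℝ) 1, m ≤ h (a + s * v)) :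
    l a + g a * v + m / 2 * v ^ 2 ≤ l (a + v) := by
  have haff : ∀ s : ℝ, HasDerivAt (fun s => a + s * v) v s := fun s => by
    simpa using ((hasDerivAt_id s).mul_const v).const_add a
  have h1 : ∀ s ∈ Set.Icc (0 : ℝ) 1, 0 ≤ g (a + s * v) * v - g a * v - m * v ^ 2 * s := by
    intro s hs
    have := le_of_hasDerivAt_nonneg_Icc
      (u := fun s => g (a + s * v) * v - g a * v - m * v ^ 2 * s)
      (u' := fun s => h (a + s * v) * v * v - m * v ^ 2 * 1)
      (fun t => ((((hg _).comp t (haff t)).mul_const v).sub_const _).sub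
        ((hasDerivAt_id t).const_mul _)) (fun t ht => ?_) hs
    · simpa using this
    · nlinarith [mul_le_mul_of_nonneg_right (hm t ht) (sq_nonneg v)]
  have h2 := le_of_hasDerivAt_nonneg_Icc
    (u := fun s => l (a + s * v) - g a * v * s - m * v ^ 2 / 2 * s ^ 2)
    (u' := fun s => g (a + s * v) * v - g a * v * 1 - m * v ^ 2 / 2 * ((2 : ℕ) * s ^ (2 - 1) * 1))
    (fun t => ((((hl _).comp t (haff t))).sub ((hasDerivAt_id t).const_mul _)).sub
        (((hasDerivAt_id t).pow 2).const_mul _)) (fun t ht => ?_) (Set.right_mem_Icc.2 zero_le_one)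
  · simp only [zero_mul, add_zero, one_mul] at h2
    linarith
  · have := h1 t ht
    push_cast
    linarith

namespace IsSmoothLoss

variable {l g h : ℝ → ℝ}

lemma add_mul_le (hl : IsSmoothLoss l g h) (a v : ℝ) : l a + g a * v ≤ l (a + v) := by
  simpa using taylor_two_le (m := 0) hl.deriv hl.deriv2 (v := v) (a := a)
    fun s _ => (hl.pos _).le

lemma le_add_mul_add (hl : IsSmoothLoss l g h) (a v : ℝ) :
    l (a + v) ≤ l a + g a * v + v ^ 2 / 2 := by
  have := taylor_two_le (m := -1) (fun t => (hl.deriv t).neg) (fun t => (hl.deriv2 t).neg)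
    (v := v) (a := a) fun s _ => neg_le_neg (hl.le_one _)
  simp only [Pi.neg_apply] at this
  linarith

lemma abs_deriv_sub_le (hl : IsSmoothLoss l g h) (a b : ℝ) : |g a - g b| ≤ |a - b| := by
  have := Convex.norm_image_sub_le_of_norm_hasDerivWithin_le (f := g) (C := 1) (s := Set.univ)
    (fun t _ => (hl.deriv2 t).hasDerivWithinAt)
    (fun t _ => by rw [Real.norm_eq_abs, abs_of_pos (hl.pos t)]; exact hl.le_one t)
    convex_univ (Set.mem_univ b) (Set.mem_univ a)
  simpa using this

/-- The positive continuous `h` has a positive minimum on a compact interval. No constant works for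
all `v` in general: the logistic and probit curvatures tend to `0` at infinity. -/
lemma exists_strong_lower_bound (hl : IsSmoothLoss l g h) (a ρ : ℝ) :
    ∃ m, 0 < m ∧ ∀ v, |v| ≤ ρ → l a + g a * v + m / 2 * v ^ 2 ≤ l (a + v) := by
  rcases lt_or_ge ρ 0 with hρ | hρ
  · exact ⟨1, one_pos, fun v hv => absurd ((abs_nonneg v).trans hv) (not_le.2 hρ)⟩
  obtain ⟨t, -, ht⟩ := (isCompact_Icc (a := a - ρ) (b := a + ρ)).exists_isMinOn
    ⟨a, by linarith, by linarith⟩ hl.cont.continuousOn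
  refine ⟨h t, hl.pos t, fun v hv => taylor_two_le hl.deriv hl.deriv2 fun s hs => ht ?_⟩
  have : |s * v| ≤ ρ := by
    rw [abs_mul, abs_of_nonneg hs.1]
    nlinarith [hs.2, abs_nonneg v]
  rw [abs_le] at this
  constructor <;> linarith [this.1, this.2]

end IsSmoothLoss

/-! ### The loss term -/

namespace Problem

variable (P : Problem n p M)

/-- The derivative of the loss of example `i`. -/
noncomputable def lossDeriv (i : Fin n) : ℝ → ℝ :=
  (P.model.exists_isSmoothLoss (P.y_admissible i)).choose

/-- The second derivative of the loss of example `i`. -/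
noncomputable def lossDeriv2 (i : Fin n) : ℝ → ℝ :=
  (P.model.exists_isSmoothLoss (P.y_admissible i)).choose_spec.choose

lemma isSmoothLoss (i : Fin n) :
    IsSmoothLoss (P.model.loss (P.y i)) (P.lossDeriv i) (P.lossDeriv2 i) :=
  (P.model.exists_isSmoothLoss (P.y_admissible i)).choose_spec.choose_spec

lemma hasFDerivAt_inner_left (z β : E p) :
    HasFDerivAt (fun β : E p => inner ℝ β z) (innerSL ℝ z) β := by
  have : (fun β : E p => inner ℝ β z) = innerSL ℝ z := by
    ext β
    rw [innerSL_apply_apply, real_inner_comm]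
  rw [this]
  exact (innerSL ℝ z).hasFDerivAt

lemma hasFDerivAt_L (β : E p) :
    HasFDerivAt P.L (∑ i, P.lossDeriv i (inner ℝ β (P.x i)) • innerSL ℝ (P.x i)) β :=
  HasFDerivAt.fun_sum fun i _ =>
    ((P.isSmoothLoss i).deriv _).comp_hasFDerivAt β (hasFDerivAt_inner_left (P.x i) β)

lemma fderiv_L :
    fderiv ℝ P.L = fun β => ∑ i, P.lossDeriv i (inner ℝ β (P.x i)) • innerSL ℝ (P.x i) :=
  funext fun β => (P.hasFDerivAt_L β).fderiv

lemma hasFDerivAt_fderiv_L (β : E p) :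
    HasFDerivAt (fderiv ℝ P.L) (∑ i, (P.lossDeriv2 i (inner ℝ β (P.x i)) •
      innerSL ℝ (P.x i)).smulRight (innerSL ℝ (P.x i))) β := by
  rw [fderiv_L]
  exact HasFDerivAt.fun_sum fun i _ => (((P.isSmoothLoss i).deriv2 _).comp_hasFDerivAt β
    (hasFDerivAt_inner_left (P.x i) β)).smul_const (innerSL ℝ (P.x i))

lemma contDiff_L : ContDiff ℝ 1 P.L :=
  contDiff_one_iff_fderiv.2 ⟨fun β => (P.hasFDerivAt_L β).differentiableAt,
    continuous_iff_continuousAt.2 fun β => (P.hasFDerivAt_fderiv_L β).continuousAt⟩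

lemma hessian_L_apply (β : E p) (j l : Fin p) :
    hessian P.L β j l =
      ∑ i, P.lossDeriv2 i (inner ℝ β (P.x i)) * P.x i j * P.x i l := by
  simp [hessian, (P.hasFDerivAt_fderiv_L β).fderiv, EuclideanSpace.inner_single_right]

lemma inner_gradient_L (β v : E p) :
    inner ℝ (gradient P.L β) v = ∑ i, P.lossDeriv i (inner ℝ β (P.x i)) * inner ℝ (P.x i) v := by
  rw [← InnerProductSpace.toDual_apply_apply (𝕜 := ℝ), toDual_gradient, fderiv_L]
  simp

/-- A Lipschitz constant of the gradient of `L`. -/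
noncomputable def lip : ℝ := ∑ i, ‖P.x i‖ ^ 2

lemma lip_nonneg : 0 ≤ P.lip := Finset.sum_nonneg fun _ _ => sq_nonneg _

lemma L_nonneg (β : E p) : 0 ≤ P.L β :=
  Finset.sum_nonneg fun i _ => (P.isSmoothLoss i).nonneg _

lemma continuous_L : Continuous P.L :=
  continuous_iff_continuousAt.2 fun β => (P.hasFDerivAt_L β).continuousAt

lemma L_add_ge (β v : E p) : P.L β + inner ℝ (gradient P.L β) v ≤ P.L (β + v) := by
  rw [inner_gradient_L, L, L, ← Finset.sum_add_distrib]
  refine Finset.sum_le_sum fun i _ => ?_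
  rw [inner_add_left, real_inner_comm v]
  exact (P.isSmoothLoss i).add_mul_le _ _

lemma L_add_le (β v : E p) :
    P.L (β + v) ≤ P.L β + inner ℝ (gradient P.L β) v + P.lip / 2 * ‖v‖ ^ 2 := by
  rw [inner_gradient_L, L, L, lip, Finset.sum_div, Finset.sum_mul, ← Finset.sum_add_distrib,
    ← Finset.sum_add_distrib]
  refine Finset.sum_le_sum fun i _ => ?_
  rw [inner_add_left, ← real_inner_comm v]
  have h1 := (P.isSmoothLoss i).le_add_mul_add (inner ℝ β (P.x i)) (inner ℝ (P.x i) v)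
  have h2 : (inner ℝ (P.x i) v) ^ 2 ≤ (‖P.x i‖ * ‖v‖) ^ 2 := by
    rw [← sq_abs]
    exact pow_le_pow_left₀ (abs_nonneg _) (abs_real_inner_le_norm _ _) 2
  rw [mul_pow] at h2
  linarith

lemma inner_gradient_sub_le (β β' v : E p) :
    |inner ℝ (gradient P.L β) v - inner ℝ (gradient P.L β') v| ≤
      P.lip * (‖β - β'‖ * ‖v‖) := by
  rw [inner_gradient_L, inner_gradient_L, ← Finset.sum_sub_distrib, lip, Finset.sum_mul]
  refine (Finset.abs_sum_le_sum_abs _ _).trans (Finset.sum_le_sum fun i _ => ?_)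
  rw [← sub_mul, abs_mul]
  have h1 := (P.isSmoothLoss i).abs_deriv_sub_le (inner ℝ β (P.x i)) (inner ℝ β' (P.x i))
  rw [← inner_sub_left] at h1
  calc _ ≤ (‖β - β'‖ * ‖P.x i‖) * (‖P.x i‖ * ‖v‖) :=
        mul_le_mul (h1.trans (abs_real_inner_le_norm _ _)) (abs_real_inner_le_norm _ _)
          (abs_nonneg _) (by positivity)
    _ = _ := by ring

/-! ### The penalty -/

/-- The penalty of a single weight. -/
noncomputable def r (t : ℝ) : ℝ := P.lam1 * |t| + P.lam2 / 2 * t ^ 2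

lemma R_eq_sum (z : E p) : P.R z = ∑ j, P.r (z j) := by
  simp [R, r, Finset.sum_add_distrib, Finset.mul_sum, EuclideanSpace.norm_sq_eq]

lemma r_lineMap_le (a b : ℝ) {t : ℝ} (ht0 : 0 ≤ t) (ht1 : t ≤ 1) :
    P.r (a + t * (b - a)) ≤ (1 - t) * P.r a + t * P.r b := by
  have h1 : |a + t * (b - a)| ≤ (1 - t) * |a| + t * |b| := by
    calc _ = |(1 - t) * a + t * b| := by ring_nf
      _ ≤ _ := (abs_add_le _ _).trans_eq (by
        rw [abs_mul, abs_mul, abs_of_nonneg ht0, abs_of_nonneg (sub_nonneg.2 ht1)])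
  have h2 : (a + t * (b - a)) ^ 2 ≤ (1 - t) * a ^ 2 + t * b ^ 2 := by
    nlinarith [mul_nonneg (mul_nonneg ht0 (sub_nonneg.2 ht1)) (sq_nonneg (b - a))]
  have h3 := mul_le_mul_of_nonneg_left h1 P.lam1_nonneg
  have h4 := mul_le_mul_of_nonneg_left h2 (div_nonneg P.lam2_nonneg zero_le_two)
  simp only [r]
  linarith

lemma R_add_smul_le (β d : E p) {t : ℝ} (ht0 : 0 ≤ t) (ht1 : t ≤ 1) :
    P.R (β + t • d) ≤ (1 - t) * P.R β + t * P.R (β + d) := by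
  rw [R_eq_sum, R_eq_sum, R_eq_sum, Finset.mul_sum, Finset.mul_sum, ← Finset.sum_add_distrib]
  refine Finset.sum_le_sum fun j _ => ?_
  simpa using P.r_lineMap_le (β j) (β j + d j) ht0 ht1

lemma L_add_smul_le (β d : E p) {t : ℝ} (ht0 : 0 ≤ t) (ht1 : t ≤ 1) :
    P.L (β + t • d) ≤ (1 - t) * P.L β + t * P.L (β + d) := by
  -- Tangent inequalities at the intermediate point towards both ends; the gradient cancels in their
  -- convex combination.
  have h1 := P.L_add_ge (β + t • d) ((-t) • d)
  have h2 := P.L_add_ge (β + t • d) ((1 - t) • d)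
  rw [inner_smul_right] at h1 h2
  rw [show β + t • d + (-t) • d = β by module] at h1
  rw [show β + t • d + (1 - t) • d = β + d by module] at h2
  nlinarith [mul_le_mul_of_nonneg_left h1 (sub_nonneg.2 ht1), mul_le_mul_of_nonneg_left h2 ht0]

lemma f_add_smul_le (β d : E p) {t : ℝ} (ht0 : 0 ≤ t) (ht1 : t ≤ 1) :
    P.f (β + t • d) ≤ (1 - t) * P.f β + t * P.f (β + d) := by
  have h1 := P.L_add_smul_le β d ht0 ht1
  have h2 := P.R_add_smul_le β d ht0 ht1
  simp only [f]
  linarith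

lemma convexOn_R : ConvexOn ℝ Set.univ P.R := by
  refine ⟨convex_univ, fun x _ y _ a b ha hb hab => ?_⟩
  have := P.R_add_smul_le x (y - x) hb (by linarith)
  obtain rfl : a = 1 - b := by linarith
  rw [add_sub_cancel] at this
  rw [show (1 - b) • x + b • y = x + b • (y - x) by module]
  simpa using this

lemma continuous_R : Continuous P.R := by
  unfold R
  fun_prop

lemma continuous_f : Continuous P.f := P.continuous_L.add P.continuous_R

/-- The objective attains its minimum as soon as there is a penalty. -/
lemma exists_isMinOn_f (h : 0 < P.lam1 ∨ 0 < P.lam2) : ∃ βs, IsMinOn P.f Set.univ βs := by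
  have hnorm : ∀ β : E p, ‖β‖ ≤ ∑ j, |β j| := fun β => by
    rw [EuclideanSpace.norm_eq, Real.sqrt_le_left (Finset.sum_nonneg fun j _ => abs_nonneg _)]
    simpa using Finset.sum_sq_le_sq_sum_of_nonneg (s := Finset.univ) (f := fun j => |β j|)
      fun j _ => abs_nonneg _
  have hR : Tendsto P.R (cocompact (E p)) atTop := by
    have hn := tendsto_norm_cocompact_atTop (E := E p)
    rcases h with h | h
    · refine tendsto_atTop_mono (fun β => ?_) (hn.const_mul_atTop h)
      have := mul_le_mul_of_nonneg_left (hnorm β) h.le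
      have := mul_nonneg (div_nonneg P.lam2_nonneg zero_le_two) (sq_nonneg ‖β‖)
      simp only [R]
      linarith
    · refine tendsto_atTop_mono (fun β => ?_)
        (((tendsto_pow_atTop two_ne_zero).comp hn).const_mul_atTop (half_pos h))
      have := mul_nonneg P.lam1_nonneg
        (Finset.sum_nonneg fun j (_ : j ∈ Finset.univ) => abs_nonneg (β j))
      simp only [R, Function.comp]
      linarith
  have hf : Tendsto P.f (cocompact (E p)) atTop :=
    tendsto_atTop_mono (fun β => le_add_of_nonneg_left (P.L_nonneg β)) hR
  obtain ⟨βs, hβs⟩ := P.continuous_f.exists_forall_le hf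
  exact ⟨βs, fun β _ => hβs β⟩

end Problem

/-! ### Quadratic forms -/

/-- The coordinate `(H v)_j`. -/
def mulCoord (H : Matrix (Fin p) (Fin p) ℝ) (v : E p) (j : Fin p) : ℝ := ∑ l, H j l * v l

lemma quadForm_eq_sum (H : Matrix (Fin p) (Fin p) ℝ) (v : E p) :
    quadForm H v = ∑ j, v j * mulCoord H v j := by
  simp only [quadForm, mulCoord, Finset.mul_sum, mul_assoc]

lemma quadForm_smul_add_smul_one (A : Matrix (Fin p) (Fin p) ℝ) (μ ν : ℝ) (v : E p) :
    quadForm (μ • (A + ν • (1 : Matrix (Fin p) (Fin p) ℝ))) v =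
      μ * (quadForm A v + ν * ‖v‖ ^ 2) := by
  have h : ∀ j, mulCoord (μ • (A + ν • (1 : Matrix (Fin p) (Fin p) ℝ))) v j =
      μ * (mulCoord A v j + ν * v j) := fun j => by
    simp [mulCoord, add_mul, Finset.sum_add_distrib, Finset.mul_sum, Matrix.one_apply, mul_add,
      mul_assoc]
  simp only [quadForm_eq_sum, h, EuclideanSpace.norm_sq_eq, Real.norm_eq_abs, sq_abs,
    Finset.mul_sum, ← Finset.sum_add_distrib]
  exact Finset.sum_congr rfl fun j _ => by ring

lemma posSemidef_of_quadForm_nonneg {A : Matrix (Fin p) (Fin p) ℝ} (hs : A.transpose = A)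
    (h : ∀ v : E p, 0 ≤ quadForm A v) : A.PosSemidef := by
  refine .of_dotProduct_mulVec_nonneg (by simpa [Matrix.IsHermitian] using hs) fun v => ?_
  refine (h (WithLp.toLp 2 v)).trans_eq ?_
  simp [quadForm_eq_sum, mulCoord, dotProduct, Matrix.mulVec]

/-- Allowing any `u` dominated by `d` covers the intermediate points of a coordinate cycle. -/
lemma abs_mulCoord_le {H : Matrix (Fin p) (Fin p) ℝ} {B : ℝ} (hB : ∀ j l, |H j l| ≤ B)
    {u d : E p} (hu : ∀ l, |u l| ≤ |d l|) (j : Fin p) :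
    |mulCoord H u j| ≤ p * (B * ‖d‖) := by
  refine (Finset.abs_sum_le_sum_abs _ _).trans ?_
  refine (Finset.sum_le_sum (g := fun _ => B * ‖d‖) fun l _ => ?_).trans_eq (by simp)
  rw [abs_mul]
  exact mul_le_mul (hB j l) ((hu l).trans (PiLp.norm_apply_le d l)) (abs_nonneg _)
    ((abs_nonneg _).trans (hB j l))

namespace Problem

variable (P : Problem n p M)

/-! ### The model matrix -/

lemma blockHessian_apply (β : E p) (j l : Fin p) : P.blockHessian β j l =
    if P.node j = P.node l then
      ∑ i, P.lossDeriv2 i (inner ℝ β (P.x i)) * P.x i j * P.x i l else 0 := by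
  simp [blockHessian, hessian_L_apply]

lemma blockHessian_transpose (β : E p) : (P.blockHessian β).transpose = P.blockHessian β := by
  ext j l
  rw [Matrix.transpose_apply, blockHessian_apply, blockHessian_apply]
  simp only [eq_comm (a := P.node l), mul_right_comm]

lemma modelMatrix_transpose (ν μ : ℝ) (β : E p) :
    (P.modelMatrix ν μ β).transpose = P.modelMatrix ν μ β := by
  simp [modelMatrix, blockHessian_transpose]

lemma modelMatrix_eq_zero (ν μ : ℝ) (β : E p) {j l : Fin p} (h : P.node j ≠ P.node l) :
    P.modelMatrix ν μ β j l = 0 := by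
  have : j ≠ l := fun e => h (congrArg _ e)
  simp [modelMatrix, blockHessian, h, this]

/-- Cutting each `x_i` into its block restrictions turns the block-diagonal part into a sum of
rank-one forms with positive weights. -/
lemma quadForm_blockHessian (β v : E p) : quadForm (P.blockHessian β) v =
    ∑ i, ∑ m, P.lossDeriv2 i (inner ℝ β (P.x i)) *
      (∑ j, (if P.node j = m then P.x i j else 0) * v j) ^ 2 := by
  have h : ∀ j l, v j * P.blockHessian β j l * v l = ∑ i, ∑ m,
      P.lossDeriv2 i (inner ℝ β (P.x i)) * (((if P.node j = m then P.x i j else 0) * v j) *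
        ((if P.node l = m then P.x i l else 0) * v l)) := by
    intro j l
    rw [blockHessian_apply]
    by_cases hjl : P.node j = P.node l
    · simp only [hjl, if_true, Finset.mul_sum, Finset.sum_mul, ite_mul, zero_mul, mul_ite,
        mul_zero, ← ite_and, and_self, Finset.sum_ite_eq, Finset.mem_univ]
      exact Finset.sum_congr rfl fun i _ => by ring
    · simp only [hjl, if_false, mul_zero, zero_mul]
      symm
      refine Finset.sum_eq_zero fun i _ => Finset.sum_eq_zero fun m _ => ?_
      by_cases hm : P.node j = m
      · simp [show P.node l ≠ m from fun e => hjl (hm.trans e.symm)]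
      · simp [hm]
  simp only [quadForm, h, sq, Finset.sum_mul_sum]
  simp only [Finset.mul_sum]
  rw [Finset.sum_congr rfl fun j _ => Finset.sum_comm, Finset.sum_comm]
  refine Finset.sum_congr rfl fun i _ => ?_
  rw [Finset.sum_congr rfl fun j _ => Finset.sum_comm, Finset.sum_comm]

lemma quadForm_blockHessian_nonneg (β v : E p) : 0 ≤ quadForm (P.blockHessian β) v := by
  rw [quadForm_blockHessian]
  exact Finset.sum_nonneg fun i _ => Finset.sum_nonneg fun m _ =>
    mul_nonneg ((P.isSmoothLoss i).pos _).le (sq_nonneg _)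

/-- Cauchy–Schwarz in each block; the squared norms of the pieces of `x_i` add up to `‖x_i‖²`. -/
lemma quadForm_blockHessian_le (β v : E p) :
    quadForm (P.blockHessian β) v ≤ P.lip * ‖v‖ ^ 2 := by
  rw [quadForm_blockHessian, lip, Finset.sum_mul]
  refine Finset.sum_le_sum fun i _ => ?_
  calc _ ≤ ∑ m, (∑ j, (if P.node j = m then P.x i j else 0) ^ 2) * ‖v‖ ^ 2 := by
        refine Finset.sum_le_sum fun m _ => ?_
        have h1 := Finset.sum_mul_sq_le_sq_mul_sq Finset.univ
          (fun j => if P.node j = m then P.x i j else 0) (fun j => v j)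
        have h2 := (P.isSmoothLoss i).le_one (inner ℝ β (P.x i))
        rw [EuclideanSpace.norm_sq_eq]
        simp only [Real.norm_eq_abs, sq_abs]
        exact (mul_le_of_le_one_left (sq_nonneg _) h2).trans h1
    _ = _ := by
        rw [← Finset.sum_mul, Finset.sum_comm]
        simp [EuclideanSpace.norm_sq_eq]

lemma abs_blockHessian_le (β : E p) (j l : Fin p) : |P.blockHessian β j l| ≤ P.lip := by
  rw [blockHessian_apply]
  split_ifs
  · refine (Finset.abs_sum_le_sum_abs _ _).trans (Finset.sum_le_sum fun i _ => ?_)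
    rw [mul_assoc, abs_mul, abs_mul, abs_of_pos ((P.isSmoothLoss i).pos _), sq]
    refine (mul_le_of_le_one_left (by positivity) ((P.isSmoothLoss i).le_one _)).trans ?_
    exact mul_le_mul (PiLp.norm_apply_le (P.x i) j) (PiLp.norm_apply_le (P.x i) l) (abs_nonneg _)
      (norm_nonneg _)
  · simpa using P.lip_nonneg

lemma le_quadForm_modelMatrix {ν μ : ℝ} (hμ : 0 ≤ μ) (β v : E p) :
    μ * ν * ‖v‖ ^ 2 ≤ quadForm (P.modelMatrix ν μ β) v := by
  rw [modelMatrix, quadForm_smul_add_smul_one]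
  nlinarith [mul_nonneg hμ (P.quadForm_blockHessian_nonneg β v)]

lemma le_modelMatrix_diag {ν μ : ℝ} (hμ : 0 ≤ μ) (β : E p) (j : Fin p) :
    μ * ν ≤ P.modelMatrix ν μ β j j := by
  have := P.le_quadForm_modelMatrix (ν := ν) hμ β (EuclideanSpace.single j 1)
  simpa [quadForm] using this

lemma abs_modelMatrix_le {ν μ μmax : ℝ} (hν : 0 ≤ ν) (hμ : 0 ≤ μ) (hμm : μ ≤ μmax) (β : E p)
    (j l : Fin p) : |P.modelMatrix ν μ β j l| ≤ μmax * (P.lip + ν) := by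
  have h1 : |ν * (1 : Matrix (Fin p) (Fin p) ℝ) j l| ≤ ν := by
    rw [Matrix.one_apply]
    split_ifs <;> simp [abs_of_nonneg hν, hν]
  calc _ = μ * |P.blockHessian β j l + ν * (1 : Matrix (Fin p) (Fin p) ℝ) j l| := by
        simp [modelMatrix, abs_mul, abs_of_nonneg hμ]
    _ ≤ μ * (P.lip + ν) := mul_le_mul_of_nonneg_left
        ((abs_add_le _ _).trans (add_le_add (P.abs_blockHessian_le β j l) h1)) hμ
    _ ≤ _ := mul_le_mul_of_nonneg_right hμm (add_nonneg P.lip_nonneg hν)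

lemma loewnerBounded_modelMatrix {ν μ μmax : ℝ} (hν : 0 ≤ ν) (hμ : 1 ≤ μ) (hμm : μ ≤ μmax)
    (β : E p) : LoewnerBounded ν (μmax * (P.lip + ν)) (P.modelMatrix ν μ β) := by
  have hq : ∀ (c d : ℝ) (v : E p), quadForm (c • P.modelMatrix ν μ β +
      d • (1 : Matrix (Fin p) (Fin p) ℝ)) v =
      c * (μ * (quadForm (P.blockHessian β) v + ν * ‖v‖ ^ 2)) + d * ‖v‖ ^ 2 := by
    intro c d v
    have h1 := quadForm_smul_add_smul_one (c • P.modelMatrix ν μ β) 1 d v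
    have h2 := quadForm_smul_add_smul_one (P.modelMatrix ν μ β) c 0 v
    have h3 := quadForm_smul_add_smul_one (P.blockHessian β) μ ν v
    rw [one_smul] at h1
    rw [zero_smul, add_zero] at h2
    rw [h1, h2, modelMatrix, h3]
    ring
  constructor
  · refine posSemidef_of_quadForm_nonneg (by simp [modelMatrix_transpose]) fun v => ?_
    have := hq 1 (-ν) v
    rw [one_smul, neg_smul, ← sub_eq_add_neg] at this
    rw [this]
    nlinarith [mul_nonneg (zero_le_one.trans hμ) (P.quadForm_blockHessian_nonneg β v),
      mul_nonneg (sub_nonneg.2 hμ) (mul_nonneg hν (sq_nonneg ‖v‖))]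
  · refine posSemidef_of_quadForm_nonneg (by simp [modelMatrix_transpose]) fun v => ?_
    have := hq (-1) (μmax * (P.lip + ν)) v
    rw [neg_smul, one_smul, add_comm, ← sub_eq_add_neg] at this
    rw [this]
    nlinarith [mul_le_mul_of_nonneg_left (P.quadForm_blockHessian_le β v) (zero_le_one.trans hμ),
      mul_nonneg (sub_nonneg.2 hμm) (mul_nonneg (add_nonneg P.lip_nonneg hν) (sq_nonneg ‖v‖))]

end Problem

/-- Used to extract first-order conditions from minimality: `s * Y` is what remains of a quadratic
term after division by `s`. -/
lemma nonneg_of_forall_add_mul_nonneg {X Y : ℝ} (h : ∀ s, 0 < s → s ≤ 1 → 0 ≤ X + s * Y) :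
    0 ≤ X := by
  have h1 : Tendsto (fun s : ℝ => X + s * Y) (𝓝[>] 0) (𝓝 X) := by
    have : Continuous fun s : ℝ => X + s * Y := by fun_prop
    simpa using (this.tendsto 0).mono_left nhdsWithin_le_nhds
  refine ge_of_tendsto h1 ?_
  filter_upwards [Ioc_mem_nhdsGT (zero_lt_one (α := ℝ))] with s hs
  exact h s hs.1 hs.2

namespace Problem

variable (P : Problem n p M)

/-! ### Coordinate descent on the quadratic model -/

/-- The contribution of coordinate `j` to the quadratic model. -/
noncomputable def modelTerm (H : Matrix (Fin p) (Fin p) ℝ) (β v : E p) (j : Fin p) : ℝ :=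
  gradient P.L β j * v j + 1 / 2 * (v j * mulCoord H v j) + (P.r (β j + v j) - P.r (β j))

/-- Optimality of the value `s` of coordinate `j` for the model linearized at `u`. -/
def CoordOptimal (H : Matrix (Fin p) (Fin p) ℝ) (β u : E p) (j : Fin p) (s : ℝ) : Prop :=
  ∀ t, 0 ≤ (gradient P.L β j + mulCoord H u j) * (t - s) + P.r (β j + t) - P.r (β j + s)

lemma inner_eq_sum (a b : E p) : inner ℝ a b = ∑ j, a j * b j := by
  simp [PiLp.inner_apply, mul_comm]

lemma penalizedModel_eq (H : Matrix (Fin p) (Fin p) ℝ) (β v : E p) :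
    penalizedModel P.L P.R H β v = P.f β + ∑ j, P.modelTerm H β v j := by
  simp only [penalizedModel, modelTerm, Finset.sum_add_distrib, Finset.sum_sub_distrib, f,
    inner_eq_sum, quadForm_eq_sum, R_eq_sum, ← Finset.mul_sum, PiLp.add_apply]
  ring

lemma penalizedModel_zero (H : Matrix (Fin p) (Fin p) ℝ) (β : E p) :
    penalizedModel P.L P.R H β 0 = P.f β := by
  simp [penalizedModel_eq, modelTerm]

lemma mulCoord_add_single (H : Matrix (Fin p) (Fin p) ℝ) (v : E p) (j k : Fin p) (t : ℝ) :
    mulCoord H (v + EuclideanSpace.single j t) k = mulCoord H v k + H k j * t := by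
  simp [mulCoord, mul_add, Finset.sum_add_distrib]

lemma quadForm_add_single {H : Matrix (Fin p) (Fin p) ℝ} (hs : H.transpose = H) (v : E p)
    (j : Fin p) (t : ℝ) : quadForm H (v + EuclideanSpace.single j t) =
      quadForm H v + 2 * mulCoord H v j * t + H j j * t ^ 2 := by
  have h : ∑ k, v k * (H k j * t) = mulCoord H v j * t := by
    rw [mulCoord, Finset.sum_mul]
    refine Finset.sum_congr rfl fun k _ => ?_
    rw [show H k j = H j k from congrFun (congrFun hs j) k]
    ring
  simp only [quadForm_eq_sum, mulCoord_add_single, PiLp.add_apply, add_mul, mul_add,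
    Finset.sum_add_distrib, h]
  simp
  ring

lemma penalizedModel_add_single {H : Matrix (Fin p) (Fin p) ℝ} (hs : H.transpose = H)
    (β v : E p) (j : Fin p) (t : ℝ) :
    penalizedModel P.L P.R H β (v + EuclideanSpace.single j t) =
      penalizedModel P.L P.R H β v + (gradient P.L β j + mulCoord H v j) * t +
        1 / 2 * H j j * t ^ 2 + P.r (β j + v j + t) - P.r (β j + v j) := by
  have hR : P.R (β + (v + EuclideanSpace.single j t)) - P.R (β + v) =
      P.r (β j + v j + t) - P.r (β j + v j) := by
    rw [R_eq_sum, R_eq_sum, ← Finset.sum_sub_distrib, Finset.sum_eq_single j]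
    · simp [add_assoc]
    · intro k _ hk
      simp [hk]
    · simp
  have hg : inner ℝ (gradient P.L β) (EuclideanSpace.single j t) = gradient P.L β j * t := by
    rw [inner_eq_sum, Finset.sum_eq_single j]
    · simp
    · intro k _ hk
      simp [hk]
    · simp
  simp only [penalizedModel, quadForm_add_single hs, inner_add_right, hg]
  linarith

/-- Minimality is tested at `τ + s (t - τ)`; convexity of `r` makes the penalty change at most
linear in `s`, and `s → 0` removes the quadratic remainder. -/
lemma coordOptimal_of_forall_le {a h τ c : ℝ}
    (hmin : ∀ t, a * τ + 1 / 2 * h * τ ^ 2 + P.r (c + τ) ≤ a * t + 1 / 2 * h * t ^ 2 + P.r (c + t))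
    (t : ℝ) : 0 ≤ (a + h * τ) * (t - τ) + P.r (c + t) - P.r (c + τ) := by
  refine nonneg_of_forall_add_mul_nonneg (Y := 1 / 2 * h * (t - τ) ^ 2) fun s hs0 hs1 => ?_
  have h1 := hmin (τ + s * (t - τ))
  have h2 := P.r_lineMap_le (c + τ) (c + t) hs0.le hs1
  rw [show c + τ + s * (c + t - (c + τ)) = c + (τ + s * (t - τ)) by ring] at h2
  refine nonneg_of_mul_nonneg_right (b := _) (a := s) ?_ hs0
  nlinarith

lemma coordOptimal_add_single {H : Matrix (Fin p) (Fin p) ℝ} (hs : H.transpose = H)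
    {β v : E p} {j : Fin p} {τ : ℝ}
    (hmin : ∀ t, penalizedModel P.L P.R H β (v + EuclideanSpace.single j τ) ≤
      penalizedModel P.L P.R H β (v + EuclideanSpace.single j t)) :
    P.CoordOptimal H β (v + EuclideanSpace.single j τ) j (v j + τ) := by
  intro t
  have h1 := P.coordOptimal_of_forall_le (a := gradient P.L β j + mulCoord H v j) (h := H j j)
    (τ := τ) (c := β j + v j) (fun t => by
      have := hmin t
      rw [P.penalizedModel_add_single hs, P.penalizedModel_add_single hs] at this
      linarith) (t - v j)
  rw [mulCoord_add_single]
  rw [show β j + v j + (t - v j) = β j + t by ring] at h1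
  rw [← add_assoc, ← add_assoc]
  linarith

/-- Optimality tested at the old value `v j` bounds the linear and penalty change by `-H j j * τ²`;
the quadratic term takes back half of it. -/
lemma penalizedModel_add_single_decrease {H : Matrix (Fin p) (Fin p) ℝ} (hs : H.transpose = H)
    {β v : E p} {j : Fin p} {τ : ℝ}
    (hmin : ∀ t, penalizedModel P.L P.R H β (v + EuclideanSpace.single j τ) ≤
      penalizedModel P.L P.R H β (v + EuclideanSpace.single j t)) :
    penalizedModel P.L P.R H β (v + EuclideanSpace.single j τ) + 1 / 2 * H j j * τ ^ 2 ≤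
      penalizedModel P.L P.R H β v := by
  have h1 := P.coordOptimal_add_single hs hmin (v j)
  rw [mulCoord_add_single, ← add_assoc, ← add_assoc] at h1
  rw [P.penalizedModel_add_single hs]
  linarith

/-- No coordinate is visited twice, so when `j` is minimized every coordinate holds either its
initial or its final value. The moves are orthogonal, so the decreases of the single steps add up to
a multiple of `‖w - v‖²`. -/
lemma coordCycle_spec {H : Matrix (Fin p) (Fin p) ℝ} (hs : H.transpose = H) {κ : ℝ}
    (hκ : ∀ j, κ ≤ H j j) {β : E p} {js : List (Fin p)} {v w : E p}
    (h : CoordCycle (penalizedModel P.L P.R H β) js v w) (hn : js.Nodup) :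
    (∀ l, l ∉ js → w l = v l) ∧
    (∀ j ∈ js, ∃ u : E p, (∀ l, u l = v l ∨ u l = w l) ∧ P.CoordOptimal H β u j (w j)) ∧
    penalizedModel P.L P.R H β w + κ / 2 * ‖w - v‖ ^ 2 ≤ penalizedModel P.L P.R H β v := by
  induction h with
  | nil v => simp
  | cons j js v w τ hmin _ ih =>
    obtain ⟨ih1, ih2, ih3⟩ := ih (List.nodup_cons.1 hn).2
    have hw : w j = v j + τ := by simpa using ih1 j (List.nodup_cons.1 hn).1
    have hl : ∀ l, (v + EuclideanSpace.single j τ) l = v l ∨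
        (v + EuclideanSpace.single j τ) l = w l := by
      intro l
      by_cases hlj : l = j
      · subst hlj
        right
        simp [hw]
      · left
        simp [hlj]
    refine ⟨fun l hlj => ?_, fun i hi => ?_, ?_⟩
    · rw [List.mem_cons, not_or] at hlj
      simpa [hlj.1] using ih1 l hlj.2
    · rcases List.mem_cons.1 hi with rfl | hi
      · exact ⟨_, hl, hw ▸ P.coordOptimal_add_single hs hmin⟩
      · obtain ⟨u, hu, hopt⟩ := ih2 i hi
        refine ⟨u, fun l => ?_, hopt⟩
        rcases hu l with hul | hul
        · exact hul ▸ hl l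
        · exact Or.inr hul
    · have h1 := P.penalizedModel_add_single_decrease hs hmin
      -- Pythagoras: by `hw` the later moves have zero `j`-th coordinate.
      have h2 : ‖w - v‖ ^ 2 = ‖w - (v + EuclideanSpace.single j τ)‖ ^ 2 + τ ^ 2 := by
        have h3 : w - v = w - (v + EuclideanSpace.single j τ) + EuclideanSpace.single j τ := by
          abel
        rw [h3, norm_add_sq_real]
        simp [EuclideanSpace.inner_single_right, hw]
      rw [h2]
      nlinarith [mul_le_mul_of_nonneg_right (hκ j) (sq_nonneg τ)]

/-- The common ground of the two solvers: the exact one allows `u = v`, the cycle gives a mixture of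
`0` and `v`. -/
lemma nodeUpdate_spec {H : Matrix (Fin p) (Fin p) ℝ} (hs : H.transpose = H) {κ : ℝ}
    (hκ : ∀ j, κ ≤ H j j) {β : E p} {m : Fin M} {solver : SubSolver} {v : E p}
    (h : NodeUpdate P.node (penalizedModel P.L P.R H β) m solver v) :
    (∀ j, P.node j ≠ m → v j = 0) ∧
    (∀ j, P.node j = m → ∃ u : E p, (∀ l, u l = 0 ∨ u l = v l) ∧ P.CoordOptimal H β u j (v j)) := by
  cases solver with
  | exact =>
    refine ⟨h.1, fun j hj => ⟨v, fun l => Or.inr rfl, ?_⟩⟩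
    -- With `τ = 0`: a block minimizer cannot be improved by moving one coordinate of its block.
    have := P.coordOptimal_add_single hs (β := β) (v := v) (j := j) (τ := 0) fun t => ?_
    · rwa [add_zero, show v + EuclideanSpace.single j (0 : ℝ) = v by simp] at this
    · rw [show v + EuclideanSpace.single j (0 : ℝ) = v by simp]
      refine h.2 _ fun k hk => ?_
      have : k ≠ j := fun e => hk (e ▸ hj)
      simp [h.1 k hk, this]
  | oneCycle =>
    obtain ⟨js, hn, hjs, hc⟩ := h
    obtain ⟨h1, h2, -⟩ := P.coordCycle_spec hs hκ hc hn
    refine ⟨fun j hj => by simpa using h1 j (mt (hjs j).1 hj), fun j hj => ?_⟩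
    obtain ⟨u, hu, hopt⟩ := h2 j ((hjs j).2 hj)
    exact ⟨u, fun l => by simpa using hu l, hopt⟩

/-! ### The combined direction -/

lemma eq_of_sum_blocks {d : E p} {v : Fin M → E p} (hd : d = ∑ m, v m)
    (hv : ∀ m j, P.node j ≠ m → v m j = 0) {j : Fin p} {m : Fin M} (hj : P.node j = m) :
    v m j = d j := by
  subst hj
  rw [hd, WithLp.ofLp_sum, Finset.sum_apply, Finset.sum_eq_single (P.node j)]
  · exact fun m _ hm => hv m j hm.symm
  · simp

lemma mulCoord_block {H : Matrix (Fin p) (Fin p) ℝ}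
    (hb : ∀ j l, P.node j ≠ P.node l → H j l = 0) {d v : E p} {j : Fin p}
    (hv : ∀ l, P.node j = P.node l → v l = d l) : mulCoord H v j = mulCoord H d j := by
  refine Finset.sum_congr rfl fun l _ => ?_
  by_cases hl : P.node j = P.node l
  · rw [hv l hl]
  · rw [hb j l hl, zero_mul, zero_mul]

/-- The quadratic model is separable over the blocks. -/
lemma penalizedModel_sub_eq_sum {H : Matrix (Fin p) (Fin p) ℝ}
    (hb : ∀ j l, P.node j ≠ P.node l → H j l = 0) (β : E p) {d : E p} {v : Fin M → E p}
    (hd : d = ∑ m, v m) (hv : ∀ m j, P.node j ≠ m → v m j = 0) :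
    penalizedModel P.L P.R H β d - penalizedModel P.L P.R H β 0 =
      ∑ m, (penalizedModel P.L P.R H β (v m) - penalizedModel P.L P.R H β 0) := by
  simp only [penalizedModel_zero]
  simp only [penalizedModel_eq, add_sub_cancel_left]
  rw [Finset.sum_comm]
  refine Finset.sum_congr rfl fun j _ => ?_
  rw [Finset.sum_eq_single (P.node j)]
  · have h1 := P.mulCoord_block hb (d := d) (v := v (P.node j)) (j := j)
      fun l hl => P.eq_of_sum_blocks hd hv hl.symm
    rw [modelTerm, modelTerm, h1, P.eq_of_sum_blocks hd hv rfl]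
  · intro m _ hm
    simp [modelTerm, hv m j hm.symm]
  · simp

lemma norm_sq_eq_sum_blocks {d : E p} {v : Fin M → E p} (hd : d = ∑ m, v m)
    (hv : ∀ m j, P.node j ≠ m → v m j = 0) : ‖d‖ ^ 2 = ∑ m, ‖v m‖ ^ 2 := by
  simp only [EuclideanSpace.norm_sq_eq]
  rw [Finset.sum_comm]
  refine Finset.sum_congr rfl fun j _ => ?_
  rw [Finset.sum_eq_single (P.node j)]
  · rw [P.eq_of_sum_blocks hd hv rfl]
  · intro m _ hm
    simp [hv m j hm.symm]
  · simp

/-- The restriction of `w` to block `m`. -/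
noncomputable def restrict (w : E p) (m : Fin M) : E p :=
  WithLp.toLp 2 fun j => if P.node j = m then w j else 0

lemma restrict_eq_zero (w : E p) (m : Fin M) (j : Fin p) (hj : P.node j ≠ m) :
    P.restrict w m j = 0 := by
  simp [restrict, hj]

lemma sum_restrict (w : E p) : w = ∑ m, P.restrict w m := by
  ext j
  rw [WithLp.ofLp_sum, Finset.sum_apply]
  simp [restrict]

/-- The direction is a combination of node updates for the model with matrix `H`. -/
def IsDirection (H : Matrix (Fin p) (Fin p) ℝ) (β : E p) (solver : SubSolver) (d : E p) : Prop :=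
  ∃ v : Fin M → E p, d = ∑ m, v m ∧
    ∀ m, NodeUpdate P.node (penalizedModel P.L P.R H β) m solver (v m)

variable {P}

/-- By separability over blocks, any competitor `w` can be compared with `d` one restriction at a
time. -/
lemma IsDirection.isMin {H : Matrix (Fin p) (Fin p) ℝ}
    (hb : ∀ j l, P.node j ≠ P.node l → H j l = 0) {β d : E p}
    (h : P.IsDirection H β .exact d) (w : E p) :
    penalizedModel P.L P.R H β d ≤ penalizedModel P.L P.R H β w := by
  obtain ⟨v, hd, hv⟩ := h
  have h1 := P.penalizedModel_sub_eq_sum hb β hd fun m => (hv m).1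
  have h2 := P.penalizedModel_sub_eq_sum hb β (P.sum_restrict w) (P.restrict_eq_zero w)
  have h3 : ∀ m, penalizedModel P.L P.R H β (v m) - penalizedModel P.L P.R H β 0 ≤
      penalizedModel P.L P.R H β (P.restrict w m) - penalizedModel P.L P.R H β 0 := fun m =>
    sub_le_sub_right ((hv m).2 _ (P.restrict_eq_zero w m)) _
  linarith [Finset.sum_le_sum fun m (_ : m ∈ Finset.univ) => h3 m]

lemma IsDirection.exists_coordOptimal {H : Matrix (Fin p) (Fin p) ℝ} (hs : H.transpose = H)
    {β d : E p} {solver : SubSolver} (h : P.IsDirection H β solver d) (j : Fin p) :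
    ∃ u : E p, (∀ l, |u l| ≤ |d l|) ∧ P.CoordOptimal H β u j (d j) := by
  -- Any lower bound of the diagonal will do: only the optimality conditions are used, not the
  -- decrease.
  obtain ⟨κ, hκ⟩ : ∃ κ, ∀ j, κ ≤ H j j := by
    obtain ⟨κ, hκ⟩ := (Set.finite_range fun j => H j j).bddBelow
    exact ⟨κ, fun j => hκ ⟨j, rfl⟩⟩
  obtain ⟨v, hd, hv⟩ := h
  have hz : ∀ m j, P.node j ≠ m → v m j = 0 := fun m => (P.nodeUpdate_spec hs hκ (hv m)).1
  obtain ⟨u, hu, hopt⟩ := (P.nodeUpdate_spec hs hκ (hv (P.node j))).2 j rfl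
  rw [P.eq_of_sum_blocks hd hz rfl] at hopt
  refine ⟨u, fun l => ?_, hopt⟩
  rcases hu l with hl | hl
  · simp [hl]
  · rw [hl]
    by_cases hjl : P.node l = P.node j
    · rw [P.eq_of_sum_blocks hd hz hjl]
    · simp [hz _ _ hjl]

lemma IsDirection.exact_coordOptimal {H : Matrix (Fin p) (Fin p) ℝ} (hs : H.transpose = H)
    (hb : ∀ j l, P.node j ≠ P.node l → H j l = 0) {β d : E p}
    (h : P.IsDirection H β .exact d) (j : Fin p) : P.CoordOptimal H β d j (d j) := by
  have := P.coordOptimal_add_single hs (β := β) (v := d) (j := j) (τ := 0) fun t => ?_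
  · rwa [add_zero, show d + EuclideanSpace.single j (0 : ℝ) = d by simp] at this
  · rw [show d + EuclideanSpace.single j (0 : ℝ) = d by simp]
    exact h.isMin hb _

/-- Sum of the coordinate conditions, all linearized at `d`, tested at `0`. -/
lemma IsDirection.exact_decrease {H : Matrix (Fin p) (Fin p) ℝ} (hs : H.transpose = H)
    (hb : ∀ j l, P.node j ≠ P.node l → H j l = 0) {β d : E p}
    (h : P.IsDirection H β .exact d) :
    inner ℝ (gradient P.L β) d + P.R (β + d) - P.R β ≤ -quadForm H d := by
  have h1 := Finset.sum_nonneg fun j (_ : j ∈ Finset.univ) => h.exact_coordOptimal hs hb j 0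
  have h2 : ∑ j, ((gradient P.L β j + mulCoord H d j) * (0 - d j) + P.r (β j + 0) -
      P.r (β j + d j)) =
      -(inner ℝ (gradient P.L β) d) - quadForm H d + P.R β - P.R (β + d) := by
    rw [inner_eq_sum, quadForm_eq_sum, R_eq_sum, R_eq_sum, ← Finset.sum_neg_distrib,
      ← Finset.sum_sub_distrib, ← Finset.sum_add_distrib, ← Finset.sum_sub_distrib]
    refine Finset.sum_congr rfl fun j _ => ?_
    simp only [add_zero, PiLp.add_apply]
    ring
  linarith

/-- The coordinate conditions are linearized at different points, so the decrease of the model along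
the cycle is used instead. It yields only half of `dᵀHd`, whence the restriction `γ ≤ 1/2` later. -/
lemma IsDirection.oneCycle_decrease {H : Matrix (Fin p) (Fin p) ℝ} (hs : H.transpose = H)
    (hb : ∀ j l, P.node j ≠ P.node l → H j l = 0) {κ : ℝ} (hκ : ∀ j, κ ≤ H j j) {β d : E p}
    (h : P.IsDirection H β .oneCycle d) :
    inner ℝ (gradient P.L β) d + P.R (β + d) - P.R β ≤
      -(1 / 2 * quadForm H d) - κ / 2 * ‖d‖ ^ 2 := by
  obtain ⟨v, hd, hv⟩ := h
  have hz : ∀ m j, P.node j ≠ m → v m j = 0 := fun m => (P.nodeUpdate_spec hs hκ (hv m)).1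
  have h1 := P.penalizedModel_sub_eq_sum hb β hd hz
  have h2 : ∀ m, penalizedModel P.L P.R H β (v m) - penalizedModel P.L P.R H β 0 ≤
      -(κ / 2 * ‖v m‖ ^ 2) := fun m => by
    obtain ⟨js, hn, -, hc⟩ := hv m
    have := (P.coordCycle_spec hs hκ hc hn).2.2
    rw [sub_zero] at this
    linarith
  have h3 := Finset.sum_le_sum fun m (_ : m ∈ Finset.univ) => h2 m
  rw [← h1, Finset.sum_neg_distrib, ← Finset.mul_sum, ← P.norm_sq_eq_sum_blocks hd hz,
    penalizedModel_zero, penalizedModel, f] at h3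
  linarith

end Problem

/-! ### Descent sequences -/

lemma tendsto_sub_succ {u : ℕ → ℝ} {a : ℝ} (hu : Tendsto u atTop (𝓝 a)) :
    Tendsto (fun k => u k - u (k + 1)) atTop (𝓝 0) := by
  simpa using hu.sub ((tendsto_add_atTop_iff_nat 1).2 hu)

/-- A sequence along which `f` decreases by at least a multiple of `‖d k‖ ^ 2` and whose
suboptimality is controlled by the decrease of `f` and by the length of `d k`. -/
structure IsDescentSeq (f : E p → ℝ) (A B c : ℝ) (β d : ℕ → E p) : Prop where
  A_nonneg : 0 ≤ A
  B_nonneg : 0 ≤ B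
  c_pos : 0 < c
  step : ∀ k, ‖β (k + 1) - β k‖ ≤ ‖d k‖
  decrease : ∀ k, f (β (k + 1)) + c * ‖d k‖ ^ 2 ≤ f (β k)
  gap : ∀ k w, f (β k) - f w ≤
    A * (f (β k) - f (β (k + 1))) + B * (‖d k‖ * ‖β k + d k - w‖)

namespace IsDescentSeq

variable {f : E p → ℝ} {A B c : ℝ} {β d : ℕ → E p}

lemma antitone (h : IsDescentSeq f A B c β d) : Antitone fun k => f (β k) :=
  antitone_nat_of_succ_le fun k => by
    nlinarith [h.decrease k, mul_nonneg h.c_pos.le (sq_nonneg ‖d k‖)]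

lemma tendsto_norm (h : IsDescentSeq f A B c β d) {a : ℝ}
    (ha : Tendsto (fun k => f (β k)) atTop (𝓝 a)) : Tendsto (fun k => ‖d k‖) atTop (𝓝 0) := by
  have h1 : Tendsto (fun k => ‖d k‖ ^ 2) atTop (𝓝 0) := by
    have h2 := (tendsto_sub_succ ha).div_const c
    rw [zero_div] at h2
    refine squeeze_zero (fun k => sq_nonneg _) (fun k => ?_) h2
    rw [le_div_iff₀ h.c_pos]
    linarith [h.decrease k]
  simpa using h1.sqrt

/-- Monotonicity makes all values converge to `f βc`; then `d k → 0`, and the right side of `gap`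
vanishes along the subsequence for every fixed `w`. -/
lemma isMinOn_of_mapClusterPt (h : IsDescentSeq f A B c β d) (hf : Continuous f) {βc : E p}
    (hc : MapClusterPt βc atTop β) : IsMinOn f Set.univ βc := by
  obtain ⟨φ, hφ, hlim⟩ := hc.tendsto_subseq
  have hlim' : Tendsto (fun k => f (β (φ k))) atTop (𝓝 (f βc)) := (hf.tendsto βc).comp hlim
  have ha : Tendsto (fun k => f (β k)) atTop (𝓝 (f βc)) :=
    (tendsto_iff_tendsto_subseq_of_antitone h.antitone hφ.tendsto_atTop).2 hlim'
  intro w _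
  have h1 := (tendsto_sub_succ ha).comp hφ.tendsto_atTop
  have h2 := (h.tendsto_norm ha).comp hφ.tendsto_atTop
  have h3 : Tendsto (fun k => ‖d (φ k)‖ + ‖β (φ k) - w‖) atTop (𝓝 (0 + ‖βc - w‖)) :=
    h2.add (hlim.sub_const w).norm
  have h4 := (h1.const_mul A).add ((h2.mul h3).const_mul B)
  rw [mul_zero, zero_mul, mul_zero, add_zero] at h4
  have h5 := le_of_tendsto_of_tendsto' (hlim'.sub_const (f w)) h4 fun k => by
    refine (h.gap (φ k) w).trans ?_
    have : ‖β (φ k) + d (φ k) - w‖ ≤ ‖d (φ k)‖ + ‖β (φ k) - w‖ := by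
      rw [show β (φ k) + d (φ k) - w = d (φ k) + (β (φ k) - w) by abel]
      exact norm_add_le _ _
    have := mul_le_mul_of_nonneg_left (mul_le_mul_of_nonneg_left this (norm_nonneg (d (φ k))))
      h.B_nonneg
    simp only [Function.comp]
    linarith
  exact sub_nonpos.1 h5

lemma norm_sub_le (h : IsDescentSeq f A B c β d) (w : E p) (k : ℕ) :
    ‖β k - w‖ ≤ ‖β 0 - w‖ + ∑ i ∈ Finset.range k, ‖d i‖ := by
  induction k with
  | zero => simp
  | succ k ih =>
    rw [Finset.sum_range_succ]
    have h1 := norm_add_le (β (k + 1) - β k) (β k - w)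
    rw [sub_add_sub_cancel] at h1
    linarith [h.step k]

lemma sum_sq_le (h : IsDescentSeq f A B c β d) (k : ℕ) :
    c * ∑ i ∈ Finset.range k, ‖d i‖ ^ 2 ≤ f (β 0) - f (β k) := by
  induction k with
  | zero => simp
  | succ k ih =>
    rw [Finset.sum_range_succ, mul_add]
    linarith [h.decrease k]

/-- The iterates may be unbounded. If the limit exceeded the minimum by `F > 0`, `gap` would bound
`‖d k‖ ‖β k + d k - βs‖` below, while the second factor is `O(√k)` and `∑ ‖d k‖²` converges. -/
lemma tendsto_of_isMinOn (h : IsDescentSeq f A B c β d) {βs : E p}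
    (hs : IsMinOn f Set.univ βs) : Tendsto (fun k => f (β k)) atTop (𝓝 (f βs)) := by
  have hmin : ∀ w, f βs ≤ f w := fun w => hs (Set.mem_univ w)
  have hbdd : BddBelow (Set.range fun k => f (β k)) := ⟨f βs, by rintro _ ⟨k, rfl⟩; exact hmin _⟩
  have ha := tendsto_atTop_ciInf h.antitone hbdd
  set a := ⨅ k, f (β k) with ha_def
  have hle : ∀ k, a ≤ f (β k) := fun k => ciInf_le hbdd k
  rcases (le_ciInf fun k => hmin (β k) : f βs ≤ a).eq_or_lt with heq | hlt
  · rwa [heq]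
  exfalso
  set F := a - f βs with hF_def
  have hF : 0 < F := sub_pos.2 hlt
  have hV : ∀ k, ∑ i ∈ Finset.range k, ‖d i‖ ^ 2 ≤ (f (β 0) - f βs) / c := fun k => by
    rw [le_div_iff₀ h.c_pos]
    linarith [h.sum_sq_le k, hmin (β k)]
  set V := (f (β 0) - f βs) / c with hV_def
  have hV0 : 0 ≤ V := by simpa using hV 0
  set W := 2 * ‖β 0 - βs‖ ^ 2 + 2 * V with hW_def
  have hW0 : 0 ≤ W := by positivity
  -- Cauchy–Schwarz on the path length: `k + 1` steps with square sum at most `V`.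
  have hρ : ∀ k, ‖β k + d k - βs‖ ^ 2 ≤ (k + 1 : ℝ) * W := fun k => by
    have h1 : ‖β k + d k - βs‖ ≤ ‖β 0 - βs‖ + ∑ i ∈ Finset.range (k + 1), ‖d i‖ := by
      rw [Finset.sum_range_succ, show β k + d k - βs = (β k - βs) + d k by abel]
      linarith [norm_add_le (β k - βs) (d k), h.norm_sub_le βs k]
    have h2 : (∑ i ∈ Finset.range (k + 1), ‖d i‖) ^ 2 ≤ (k + 1 : ℝ) * V := by
      have := sq_sum_le_card_mul_sum_sq (s := Finset.range (k + 1)) (f := fun i => ‖d i‖)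
      rw [Finset.card_range] at this
      push_cast at this
      exact this.trans (mul_le_mul_of_nonneg_left (hV _) (by positivity))
    have h3 := pow_le_pow_left₀ (norm_nonneg _) h1 2
    have h4 := add_sq_le (a := ‖β 0 - βs‖) (b := ∑ i ∈ Finset.range (k + 1), ‖d i‖)
    have h5 : 0 ≤ (k : ℝ) * ‖β 0 - βs‖ ^ 2 := by positivity
    nlinarith
  have hsum : Summable fun k => ‖d k‖ ^ 2 :=
    summable_of_sum_range_le (fun k => sq_nonneg _) hV
  have hev : ∀ᶠ k in atTop, A * (f (β k) - f (β (k + 1))) ≤ F / 2 := by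
    have := (tendsto_sub_succ ha).const_mul A
    rw [mul_zero] at this
    exact this.eventually_le_const (by linarith)
  have hbound : ∀ᶠ k : ℕ in atTop,
      ‖(1 : ℝ) / ((k + 1 : ℕ) : ℝ)‖ ≤ 4 * B ^ 2 * W / F ^ 2 * ‖d k‖ ^ 2 := by
    filter_upwards [hev] with k hk
    have h1 : F / 2 ≤ B * (‖d k‖ * ‖β k + d k - βs‖) := by
      linarith [h.gap k βs, hle k]
    have h2 := pow_le_pow_left₀ (by positivity) h1 2
    rw [mul_pow, mul_pow] at h2
    have h3 := mul_le_mul_of_nonneg_left (hρ k)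
      (mul_nonneg (sq_nonneg B) (sq_nonneg ‖d k‖))
    have hk0 : (0 : ℝ) < k + 1 := by positivity
    rw [Real.norm_of_nonneg (by positivity), div_le_iff₀ (by positivity)]
    push_cast
    rw [show 4 * B ^ 2 * W / F ^ 2 * ‖d k‖ ^ 2 * (k + 1 : ℝ) =
      (4 * B ^ 2 * W * ‖d k‖ ^ 2 * (k + 1 : ℝ)) / F ^ 2 by ring, le_div_iff₀ (by positivity)]
    nlinarith
  have h1 : Summable fun k : ℕ => (1 : ℝ) / ((k + 1 : ℕ) : ℝ) :=
    Summable.of_norm_bounded_eventually_nat (hsum.mul_left _) hbound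
  exact Real.not_summable_one_div_natCast ((summable_nat_add_iff 1).1 h1)

lemma exists_contraction (h : IsDescentSeq f A B c β d) {βs : E p} {m : ℝ} (hm : 0 < m)
    (hg : ∀ k, m * ‖β k - βs‖ ^ 2 ≤ f (β k) - f βs) :
    ∃ q ∈ Set.Ico (0 : ℝ) 1, ∀ k, f (β (k + 1)) - f βs ≤ q * (f (β k) - f βs) := by
  have hc := h.c_pos
  have hA := h.A_nonneg
  have hB := h.B_nonneg
  -- The terms collect the coefficients from `gap`, `h4` and `h5`; the `1` keeps the contraction
  -- factor in `[0, 1)`.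
  set A' := A + B / c + B ^ 2 / (2 * m * c) + 1 with hA'
  have hA'1 : 1 ≤ A' := by
    rw [hA']
    linarith [div_nonneg hB hc.le, show 0 ≤ B ^ 2 / (2 * m * c) by positivity]
  have hq : 1 / (2 * A') ≤ 1 := by
    rw [div_le_one (by linarith)]
    linarith
  refine ⟨1 - 1 / (2 * A'), ⟨by linarith, by linarith [show 0 < 1 / (2 * A') by positivity]⟩,
    fun k => ?_⟩
  have hd : ‖d k‖ ^ 2 ≤ (f (β k) - f (β (k + 1))) / c := by
    rw [le_div_iff₀ hc]
    linarith [h.decrease k]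
  have hF : 0 ≤ f (β k) - f (β (k + 1)) := sub_nonneg.2 (h.antitone (Nat.le_succ k))
  have h1 : ‖β k + d k - βs‖ ≤ ‖β k - βs‖ + ‖d k‖ := by
    rw [show β k + d k - βs = (β k - βs) + d k by abel]
    exact norm_add_le _ _
  have h2 : B * (‖d k‖ * ‖β k + d k - βs‖) ≤ B * (‖d k‖ * (‖β k - βs‖ + ‖d k‖)) := by gcongr
  -- Young's inequality, weighted so that quadratic growth absorbs the first term into half of the
  -- gap.
  have h3 : B * (‖d k‖ * ‖β k - βs‖) ≤
      m / 2 * ‖β k - βs‖ ^ 2 + B ^ 2 / (2 * m) * ‖d k‖ ^ 2 := by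
    have : 0 ≤ (m * ‖β k - βs‖ - B * ‖d k‖) ^ 2 / (2 * m) := by positivity
    have e : (m * ‖β k - βs‖ - B * ‖d k‖) ^ 2 / (2 * m) = m / 2 * ‖β k - βs‖ ^ 2 +
        B ^ 2 / (2 * m) * ‖d k‖ ^ 2 - B * (‖d k‖ * ‖β k - βs‖) := by
      field_simp
      ring
    linarith
  have h4 : B * ‖d k‖ ^ 2 ≤ B / c * (f (β k) - f (β (k + 1))) :=
    (mul_le_mul_of_nonneg_left hd hB).trans_eq (by ring)
  have h5 : B ^ 2 / (2 * m) * ‖d k‖ ^ 2 ≤ B ^ 2 / (2 * m * c) * (f (β k) - f (β (k + 1))) :=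
    (mul_le_mul_of_nonneg_left hd (by positivity)).trans_eq (by field_simp)
  have h6 : (f (β k) - f βs) / 2 ≤ A' * (f (β k) - f (β (k + 1))) := by
    rw [hA']
    nlinarith [h.gap k βs, hg k]
  have h7 : (f (β k) - f βs) * (1 / (2 * A')) ≤ f (β k) - f (β (k + 1)) := by
    rw [mul_one_div, div_le_iff₀ (by linarith)]
    linarith
  linarith

lemma qLinear_and_rLinear (h : IsDescentSeq f A B c β d) {βs : E p}
    (hs : IsMinOn f Set.univ βs) {m : ℝ} (hm : 0 < m)
    (hg : ∀ k, m * ‖β k - βs‖ ^ 2 ≤ f (β k) - f βs) :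
    QLinear (fun k => f (β k)) (f βs) ∧ RLinear β βs := by
  have hF : ∀ k, 0 ≤ f (β k) - f βs := fun k => sub_nonneg.2 (hs (Set.mem_univ _))
  obtain ⟨q, hq, hstep⟩ := h.exists_contraction hm hg
  refine ⟨⟨q, hq, Eventually.of_forall fun k => ?_⟩,
    √((f (β 0) - f βs) / m), √q, ⟨Real.sqrt_nonneg q, ?_⟩, fun k => ?_⟩
  · rw [abs_of_nonneg (hF _), abs_of_nonneg (hF _)]
    exact hstep k
  · rw [Real.sqrt_lt' one_pos]
    simpa using hq.2
  · have h1 : f (β k) - f βs ≤ q ^ k * (f (β 0) - f βs) := by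
      induction k with
      | zero => simp
      | succ k ih =>
        refine (hstep k).trans ((mul_le_mul_of_nonneg_left ih hq.1).trans_eq ?_)
        ring
    refine le_of_sq_le_sq ?_ (by positivity)
    rw [mul_pow, Real.sq_sqrt (div_nonneg (hF 0) hm.le), ← pow_mul, mul_comm k, pow_mul,
      Real.sq_sqrt hq.1, div_mul_eq_mul_div, le_div_iff₀ hm]
    linarith [hg k]

end IsDescentSeq

namespace Problem

variable (P : Problem n p M)

/-! ### Sufficient decrease -/

lemma f_add_smul_le_model (β d : E p) {t : ℝ} (ht0 : 0 ≤ t) (ht1 : t ≤ 1) :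
    P.f (β + t • d) ≤ P.f β + t * (inner ℝ (gradient P.L β) d + P.R (β + d) - P.R β) +
      P.lip / 2 * t ^ 2 * ‖d‖ ^ 2 := by
  have h1 := P.L_add_le β (t • d)
  have h2 := P.R_add_smul_le β d ht0 ht1
  rw [inner_smul_right, norm_smul, mul_pow, Real.norm_eq_abs, sq_abs] at h1
  simp only [f]
  linarith

variable {P}

lemma IsDirection.decrease {ν μ : ℝ} (hμ : 0 ≤ μ) {β d : E p} {solver : SubSolver}
    (h : P.IsDirection (P.modelMatrix ν μ β) β solver d) :
    inner ℝ (gradient P.L β) d + P.R (β + d) - P.R β ≤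
      -(1 / 2 * quadForm (P.modelMatrix ν μ β) d) - μ * ν / 2 * ‖d‖ ^ 2 := by
  cases solver with
  | exact =>
    have h1 := h.exact_decrease (P.modelMatrix_transpose ν μ β)
      fun j l => P.modelMatrix_eq_zero ν μ β
    linarith [P.le_quadForm_modelMatrix (ν := ν) hμ β d]
  | oneCycle =>
    exact h.oneCycle_decrease (P.modelMatrix_transpose ν μ β)
      (fun j l => P.modelMatrix_eq_zero ν μ β) fun j => P.le_modelMatrix_diag hμ β j

/-- The full step is accepted when the scaling factor is large. -/
lemma IsDirection.sufficientDecrease_one (prm : Params) {μ : ℝ} (hμ : 0 ≤ μ)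
    (hμl : P.lip / (2 * prm.ν * (1 - prm.σ)) ≤ μ) {β d : E p} {solver : SubSolver}
    (h : P.IsDirection (P.modelMatrix prm.ν μ β) β solver d) :
    SufficientDecrease P.f prm.σ
      (predictedDecrease P.L P.R (P.modelMatrix prm.ν μ β) prm.γ β d) β d 1 := by
  have hν := prm.ν_pos
  have hσ : 0 < 1 - prm.σ := sub_pos.2 prm.σ_lt_one
  have h1 := P.f_add_smul_le_model β d zero_le_one le_rfl
  have h2 := h.decrease hμ
  have h3 := P.le_quadForm_modelMatrix (ν := prm.ν) hμ β d
  rw [div_le_iff₀ (by positivity)] at hμl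
  have h4 : 0 ≤ quadForm (P.modelMatrix prm.ν μ β) d := le_trans (by positivity) h3
  -- The `γ` term only relaxes the test, so no restriction `γ ≤ 1/2` is needed here.
  have h5 := mul_nonneg (mul_nonneg prm.σ_pos.le prm.γ_nonneg) h4
  have h6 : inner ℝ (gradient P.L β) d + P.R (β + d) - P.R β ≤ -(μ * prm.ν * ‖d‖ ^ 2) := by
    linarith
  have h7 := mul_le_mul_of_nonneg_left h6 hσ.le
  have h8 := mul_le_mul_of_nonneg_right hμl (sq_nonneg ‖d‖)
  unfold SufficientDecrease predictedDecrease
  nlinarith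

/-- The constant in the bound `D ≤ -c ‖d‖²` for the predicted decrease. -/
noncomputable def decreaseConst (prm : Params) : ℝ := min ((1 - prm.γ) * prm.ν) (prm.ν / 2)

lemma decreaseConst_pos (prm : Params) : 0 < decreaseConst prm :=
  lt_min (mul_pos (sub_pos.2 prm.γ_lt_one) prm.ν_pos) (half_pos prm.ν_pos)

lemma IsDirection.predictedDecrease_le (prm : Params) {μ : ℝ} (hμ : 1 ≤ μ) {β d : E p}
    {solver : SubSolver} (hγ : solver = .oneCycle → prm.γ ≤ 1 / 2)
    (h : P.IsDirection (P.modelMatrix prm.ν μ β) β solver d) :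
    predictedDecrease P.L P.R (P.modelMatrix prm.ν μ β) prm.γ β d ≤
      -(decreaseConst prm * ‖d‖ ^ 2) := by
  have hμ0 : 0 ≤ μ := zero_le_one.trans hμ
  have hq := P.le_quadForm_modelMatrix (ν := prm.ν) hμ0 β d
  have hq' : prm.ν * ‖d‖ ^ 2 ≤ μ * prm.ν * ‖d‖ ^ 2 := by
    nlinarith [mul_nonneg (sub_nonneg.2 hμ) (mul_nonneg prm.ν_pos.le (sq_nonneg ‖d‖))]
  unfold predictedDecrease
  cases solver with
  | exact =>
    have h1 := h.exact_decrease (P.modelMatrix_transpose prm.ν μ β)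
      fun j l => P.modelMatrix_eq_zero prm.ν μ β
    have h2 := mul_le_mul_of_nonneg_right (min_le_left ((1 - prm.γ) * prm.ν) (prm.ν / 2))
      (sq_nonneg ‖d‖)
    have h3 := mul_le_mul_of_nonneg_left (hq'.trans hq) (sub_nonneg.2 prm.γ_lt_one.le)
    rw [decreaseConst]
    linarith
  | oneCycle =>
    have h1 := h.decrease hμ0
    have h2 := mul_le_mul_of_nonneg_right (min_le_right ((1 - prm.γ) * prm.ν) (prm.ν / 2))
      (sq_nonneg ‖d‖)
    have h3 := mul_nonneg (sub_nonneg.2 (hγ rfl))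
      ((mul_nonneg prm.ν_pos.le (sq_nonneg ‖d‖)).trans (hq'.trans hq))
    rw [decreaseConst]
    linarith

variable (P)

/-- Steps of at most this size are acceptable. -/
noncomputable def safeStep (prm : Params) : ℝ :=
  min 1 (2 * (1 - prm.σ) * decreaseConst prm / (P.lip + 1))

lemma safeStep_pos (prm : Params) : 0 < P.safeStep prm :=
  lt_min one_pos (div_pos (mul_pos (mul_pos two_pos (sub_pos.2 prm.σ_lt_one))
    (decreaseConst_pos prm)) (by linarith [P.lip_nonneg]))

lemma sufficientDecrease_of_le_safeStep (prm : Params) {H : Matrix (Fin p) (Fin p) ℝ} {β d : E p}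
    (hH : 0 ≤ quadForm H d)
    (hD : predictedDecrease P.L P.R H prm.γ β d ≤ -(decreaseConst prm * ‖d‖ ^ 2)) {t : ℝ}
    (ht0 : 0 ≤ t) (ht : t ≤ P.safeStep prm) :
    SufficientDecrease P.f prm.σ (predictedDecrease P.L P.R H prm.γ β d) β d t := by
  have hl := P.lip_nonneg
  have h1 := P.f_add_smul_le_model β d ht0 (ht.trans (min_le_left _ _))
  have h2 := ht.trans (min_le_right _ _)
  rw [le_div_iff₀ (by linarith)] at h2
  set D := predictedDecrease P.L P.R H prm.γ β d with hD_def
  have h3 : inner ℝ (gradient P.L β) d + P.R (β + d) - P.R β ≤ D := by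
    rw [hD_def, predictedDecrease]
    linarith [mul_nonneg prm.γ_nonneg hH]
  have h4 := mul_le_mul_of_nonneg_left hD (sub_nonneg.2 prm.σ_lt_one.le)
  -- The denominator `lip + 1` in `safeStep` avoids division by zero; the surplus `t` is dropped.
  have h5 : t * P.lip ≤ 2 * (1 - prm.σ) * decreaseConst prm := by nlinarith
  have h6 := mul_le_mul_of_nonneg_right h5 (sq_nonneg ‖d‖)
  have h7 : (1 - prm.σ) * D + P.lip / 2 * t * ‖d‖ ^ 2 ≤ 0 := by linarith
  have h8 := mul_nonneg ht0 (neg_nonneg.2 h7)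
  have h9 := mul_le_mul_of_nonneg_left h3 ht0
  unfold SufficientDecrease
  nlinarith

/-- A lower bound for all step sizes. -/
noncomputable def minStep (prm : Params) : ℝ := min prm.δ (prm.b * P.safeStep prm)

lemma minStep_pos (prm : Params) : 0 < P.minStep prm :=
  lt_min prm.δ_pos (mul_pos prm.b_pos (P.safeStep_pos prm))

lemma lineSearch_spec (prm : Params) {H : Matrix (Fin p) (Fin p) ℝ} {β d : E p}
    (hH : 0 ≤ quadForm H d)
    (hD : predictedDecrease P.L P.R H prm.γ β d ≤ -(decreaseConst prm * ‖d‖ ^ 2)) {α : ℝ}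
    (h : LineSearch P.f prm (predictedDecrease P.L P.R H prm.γ β d) β d α) :
    P.minStep prm ≤ α ∧ α ≤ 1 ∧
      SufficientDecrease P.f prm.σ (predictedDecrease P.L P.R H prm.γ β d) β d α := by
  rcases h with ⟨h, rfl⟩ | ⟨-, αi, hαi, -, j, rfl, hsuf, hj⟩
  · exact ⟨(min_le_left _ _).trans prm.δ_lt_one.le, le_rfl, h⟩
  · have h0 : 0 ≤ αi := prm.δ_pos.le.trans hαi.1
    refine ⟨?_, mul_le_one₀ hαi.2 (pow_nonneg prm.b_pos.le j)
      (pow_le_one₀ prm.b_pos.le prm.b_lt_one.le), hsuf⟩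
    rcases j with - | j
    · rw [pow_zero, mul_one]
      exact (min_le_left _ _).trans hαi.1
    · refine (min_le_right _ _).trans ?_
      -- The trial just before the accepted one was rejected, hence was larger than the safe step.
      have h1 : P.safeStep prm < αi * prm.b ^ j := by
        by_contra hlt
        exact hj j (Nat.lt_succ_self j) (P.sufficientDecrease_of_le_safeStep prm hH hD
          (mul_nonneg h0 (pow_nonneg prm.b_pos.le j)) (not_lt.1 hlt))
      rw [pow_succ, ← mul_assoc, mul_comm _ prm.b]
      exact mul_le_mul_of_nonneg_left h1.le prm.b_pos.le

/-! ### Suboptimality of the trial point -/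

variable {P}

/-- The coordinate conditions are tested at `w` and summed. Convexity of `L` at `β + d` brings in `f
w`; moving the gradient from `β` to `β + d` costs `lip ‖d‖`, and the terms `H u` cost `p² C ‖d‖`. -/
lemma IsDirection.f_add_sub_le {H : Matrix (Fin p) (Fin p) ℝ} (hs : H.transpose = H) {C : ℝ}
    (hC : ∀ j l, |H j l| ≤ C) {β d : E p} {solver : SubSolver}
    (h : P.IsDirection H β solver d) (w : E p) :
    P.f (β + d) - P.f w ≤ (P.lip + p ^ 2 * C) * (‖d‖ * ‖β + d - w‖) := by
  choose u hu hopt using h.exists_coordOptimal hs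
  set z := β + d with hz
  have h1 := Finset.sum_nonneg fun j (_ : j ∈ Finset.univ) => hopt j (w j - β j)
  have h2 : ∑ j, ((gradient P.L β j + mulCoord H (u j) j) * (w j - β j - d j) +
      P.r (β j + (w j - β j)) - P.r (β j + d j)) = inner ℝ (gradient P.L β) (w - z) +
        ∑ j, mulCoord H (u j) j * (w - z) j + P.R w - P.R z := by
    rw [inner_eq_sum, R_eq_sum, R_eq_sum, ← Finset.sum_add_distrib, ← Finset.sum_add_distrib,
      ← Finset.sum_sub_distrib]
    refine Finset.sum_congr rfl fun j _ => ?_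
    simp only [hz, PiLp.add_apply, PiLp.sub_apply, add_sub_cancel]
    ring
  have h3 : ∑ j, mulCoord H (u j) j * (w - z) j ≤ p ^ 2 * C * (‖d‖ * ‖w - z‖) := by
    refine (Finset.sum_le_sum (g := fun _ => p * (C * ‖d‖) * ‖w - z‖) fun j _ => ?_).trans_eq ?_
    · refine (le_abs_self _).trans ?_
      rw [abs_mul]
      have := abs_mulCoord_le hC (hu j) j
      exact mul_le_mul this (PiLp.norm_apply_le (w - z) j) (abs_nonneg _)
        ((abs_nonneg _).trans this)
    · simp
      ring
  have h4 := P.L_add_ge z (w - z)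
  rw [add_sub_cancel] at h4
  have h5 := (le_abs_self _).trans (P.inner_gradient_sub_le β z (w - z))
  rw [show β - z = -d by rw [hz]; abel, norm_neg] at h5
  rw [norm_sub_rev z w]
  simp only [f]
  linarith

/-! ### Runs of d-GLMNET -/

lemma IsRun.isDescentSeq {prm : Params} {solver : SubSolver}
    (hγ : solver = .oneCycle → prm.γ ≤ 1 / 2) {μmax : ℝ} {μ : ℕ → ℝ} {β d : ℕ → E p} {α : ℕ → ℝ}
    (hμ : ∀ k, 1 ≤ μ k ∧ μ k ≤ μmax) (h : P.IsRun prm solver μ β d α) :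
    IsDescentSeq P.f (1 / P.minStep prm) (P.lip + p ^ 2 * (μmax * (P.lip + prm.ν)))
      (P.minStep prm * prm.σ * decreaseConst prm) β d := by
  have hmin := P.minStep_pos prm
  have hc := decreaseConst_pos prm
  have hσ := prm.σ_pos
  have hl := P.lip_nonneg
  have hμ0 : ∀ k, 0 ≤ μ k := fun k => zero_le_one.trans (hμ k).1
  have hdir : ∀ k, P.IsDirection (P.modelMatrix prm.ν (μ k) (β k)) (β k) solver (d k) :=
    h.direction
  have hD := fun k => (hdir k).predictedDecrease_le prm (hμ k).1 hγ
  have hls := fun k => P.lineSearch_spec prm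
    ((by have := hμ0 k; have := prm.ν_pos; positivity : (0 : ℝ) ≤ _).trans
      (P.le_quadForm_modelMatrix (ν := prm.ν) (hμ0 k) (β k) (d k))) (hD k) (h.lineSearch k)
  have hdec : ∀ k, P.f (β (k + 1)) + P.minStep prm * prm.σ * decreaseConst prm * ‖d k‖ ^ 2 ≤
      P.f (β k) := fun k => by
    obtain ⟨h1, -, h3⟩ := hls k
    rw [h.update k]
    unfold SufficientDecrease at h3
    have h4 := mul_le_mul_of_nonneg_left (hD k)
      (mul_nonneg (hmin.le.trans h1) hσ.le)
    have h5 := mul_le_mul_of_nonneg_right h1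
      (mul_nonneg hσ.le (mul_nonneg hc.le (sq_nonneg ‖d k‖)))
    linarith
  refine ⟨by positivity, ?_, by positivity, fun k => ?_, hdec, fun k w => ?_⟩
  · have : 0 ≤ μmax := (hμ0 0).trans (hμ 0).2
    have := prm.ν_pos
    positivity
  · obtain ⟨h1, h2, -⟩ := hls k
    rw [h.update k, add_sub_cancel_left, norm_smul, Real.norm_of_nonneg (hmin.le.trans h1)]
    exact mul_le_of_le_one_left (norm_nonneg _) h2
  · obtain ⟨h1, h2, -⟩ := hls k
    have h3 := (hdir k).f_add_sub_le (P.modelMatrix_transpose _ _ _)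
      (P.abs_modelMatrix_le prm.ν_pos.le (hμ0 k) (hμ k).2 (β k)) w
    have h4 := P.f_add_smul_le (β k) (d k) (hmin.le.trans h1) h2
    rw [← h.update k] at h4
    have h5 : 0 ≤ P.f (β k) - P.f (β (k + 1)) := by
      have : 0 ≤ P.minStep prm * prm.σ * decreaseConst prm * ‖d k‖ ^ 2 := by positivity
      linarith [hdec k]
    have hα := hmin.trans_le h1
    -- Convexity along the segment: the damped step realizes at least the fraction `α k` of the full
    -- change.
    have h6 : P.f (β k) - P.f (β k + d k) ≤ (P.f (β k) - P.f (β (k + 1))) / α k := by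
      rw [le_div_iff₀ hα]
      linarith
    have h7 : (P.f (β k) - P.f (β (k + 1))) / α k ≤
        1 / P.minStep prm * (P.f (β k) - P.f (β (k + 1))) := by
      rw [one_div_mul_eq_div]
      exact div_le_div_of_nonneg_left h5 hmin h1
    linarith

lemma IsRun.isCGD {prm : Params} {μmax : ℝ} {μ : ℕ → ℝ} {β d : ℕ → E p} {α : ℕ → ℝ}
    (hμ : ∀ k, 1 ≤ μ k ∧ μ k ≤ μmax) (h : P.IsRun prm .exact μ β d α) :
    IsCGD P.L P.R prm.ν (μmax * (P.lip + prm.ν)) prm.b prm.σ prm.γ (fun _ => Finset.univ)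
      (fun k => P.modelMatrix prm.ν (μ k) (β k)) β d α where
  smooth := P.contDiff_L
  convex := P.convexOn_R
  separable := ⟨fun _ => P.r, P.R_eq_sum⟩
  emin_pos := prm.ν_pos
  b_mem := ⟨prm.b_pos, prm.b_lt_one⟩
  σ_mem := ⟨prm.σ_pos, prm.σ_lt_one⟩
  γ_mem := ⟨prm.γ_nonneg, prm.γ_lt_one⟩
  bounds k := P.loewnerBounded_modelMatrix prm.ν_pos.le (hμ k).1 (hμ k).2 (β k)
  schedule := ⟨1, le_rfl, fun _ j => ⟨0, one_pos, Finset.mem_univ j⟩⟩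
  direction_supp _ j hj := absurd (Finset.mem_univ j) hj
  direction_min k w _ := by
    have hd : P.IsDirection (P.modelMatrix prm.ν (μ k) (β k)) (β k) .exact (d k) := h.direction k
    exact hd.isMin (fun j l => P.modelMatrix_eq_zero _ _ _) w
  armijo := by
    refine ⟨prm.δ, 1, prm.δ_pos, fun k => ?_⟩
    rcases h.lineSearch k with ⟨h1, h2⟩ | ⟨-, αi, hαi, -, h1⟩
    -- An accepted full step is an Armijo step with initial size `1` and no backtracking.
    · exact ⟨1, ⟨prm.δ_lt_one.le, le_rfl⟩, 0, by simp [h2], h2 ▸ h1,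
        fun i hi => absurd hi (by simp)⟩
    · exact ⟨αi, hαi, h1⟩
  update := h.update

lemma IsRun.step_eq_one {prm : Params} {solver : SubSolver} {μ : ℕ → ℝ} {β d : ℕ → E p}
    {α : ℕ → ℝ} (h : P.IsRun prm solver μ β d α) {k : ℕ} (hμ : 0 ≤ μ k)
    (hμl : P.lip / (2 * prm.ν * (1 - prm.σ)) ≤ μ k) : α k = 1 := by
  have hd : P.IsDirection (P.modelMatrix prm.ν (μ k) (β k)) (β k) solver (d k) := h.direction k
  rcases h.lineSearch k with ⟨-, h2⟩ | ⟨h1, -⟩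
  · exact h2
  · exact absurd (hd.sufficientDecrease_one prm hμ hμl) h1

/-- A factor `η₁` is applied only after `α k < 1`, which forces `μ k` below the acceptance
threshold. -/
lemma IsRun.adaptive_bounds {prm : Params} {solver : SubSolver} {μ : ℕ → ℝ} {β d : ℕ → E p}
    {α : ℕ → ℝ} (h : P.IsRun prm solver μ β d α) {η₁ η₂ : ℝ} (h1 : 1 ≤ η₁) (h2 : 1 ≤ η₂)
    (hμ : AdaptiveRule η₁ η₂ α μ) (k : ℕ) :
    1 ≤ μ k ∧ μ k ≤ η₁ * max 1 (P.lip / (2 * prm.ν * (1 - prm.σ))) := by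
  set c := P.lip / (2 * prm.ν * (1 - prm.σ))
  have hmax : 1 ≤ η₁ * max 1 c := one_le_mul_of_one_le_of_one_le h1 (le_max_left _ _)
  induction k with
  | zero => simpa [hμ.1] using hmax
  | succ k ih =>
    rw [hμ.2 k]
    split_ifs with hα
    · refine ⟨one_le_mul_of_one_le_of_one_le h1 ih.1,
        mul_le_mul_of_nonneg_left ?_ (zero_le_one.trans h1)⟩
      by_contra hlt
      exact hα.ne (h.step_eq_one (zero_le_one.trans ih.1)
        ((le_max_right 1 c).trans (not_le.1 hlt).le))
    · exact ⟨le_max_left _ _, max_le hmax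
        ((div_le_self (zero_le_one.trans ih.1) h2).trans ih.2)⟩

/-! ### Quadratic growth -/

variable (P)

lemma inner_gradient_add_R_nonneg {βs : E p} (hs : IsMinOn P.f Set.univ βs) (v : E p) :
    0 ≤ inner ℝ (gradient P.L βs) v + P.R (βs + v) - P.R βs := by
  refine nonneg_of_forall_add_mul_nonneg (Y := P.lip / 2 * ‖v‖ ^ 2) fun s hs0 hs1 => ?_
  have h1 := P.f_add_smul_le_model βs v hs0.le hs1
  have h2 : P.f βs ≤ P.f (βs + s • v) := hs (Set.mem_univ _)
  refine nonneg_of_mul_nonneg_right (b := _) (a := s) ?_ hs0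
  nlinarith

/-- If all `⟨x_i, v⟩` vanished for some `v ≠ 0`, `L` would be constant along `v`, against strict
convexity. An injective linear map in finite dimension is bounded below. -/
lemma exists_sum_inner_sq_lower_bound (hL : StrictConvexOn ℝ Set.univ P.L) :
    ∃ κ, 0 < κ ∧ ∀ v : E p, κ * ‖v‖ ^ 2 ≤ ∑ i, (inner ℝ (P.x i) v) ^ 2 := by
  let X : E p →ₗ[ℝ] EuclideanSpace ℝ (Fin n) :=
    (WithLp.linearEquiv 2 ℝ (Fin n → ℝ)).symm.toLinearMap ∘ₗ
      LinearMap.pi fun i => (innerSL ℝ (P.x i)).toLinearMap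
  have hX : ∀ v i, X v i = inner ℝ (P.x i) v := fun v i => rfl
  have hker : LinearMap.ker X = ⊥ := by
    rw [LinearMap.ker_eq_bot']
    intro v hv
    by_contra hne
    have h0 : ∀ (t : ℝ) i, inner ℝ (t • v) (P.x i) = 0 := fun t i => by
      rw [inner_smul_left, real_inner_comm, ← hX, hv]
      simp
    have hLt : ∀ t : ℝ, P.L (t • v) = P.L 0 := fun t => by simp [L, h0]
    have := hL.2 (Set.mem_univ ((0 : ℝ) • v)) (Set.mem_univ ((1 : ℝ) • v))
      (by simpa using Ne.symm hne) (half_pos one_pos) (half_pos one_pos) (add_halves (1 : ℝ))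
    rw [smul_smul, smul_smul, ← add_smul, hLt, hLt, hLt, smul_eq_mul] at this
    linarith
  obtain ⟨K, hK, hX'⟩ := X.exists_antilipschitzWith hker
  refine ⟨1 / (K : ℝ) ^ 2, by positivity, fun v => ?_⟩
  have h1 : ‖v‖ ≤ K * ‖X v‖ := by simpa using hX'.le_mul_dist v 0
  have h2 := pow_le_pow_left₀ (norm_nonneg _) h1 2
  have h3 : ‖X v‖ ^ 2 = ∑ i, (inner ℝ (P.x i) v) ^ 2 := by
    rw [EuclideanSpace.norm_sq_eq]
    simp [hX]
  rw [one_div_mul_eq_div, div_le_iff₀ (by positivity), ← h3]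
  linarith

/-- For `‖v‖ ≤ 1` the arguments of the losses move in bounded intervals, where the losses are
strongly convex; the first-order terms are nonnegative by optimality of `βs`. -/
lemma exists_local_growth (hL : StrictConvexOn ℝ Set.univ P.L) {βs : E p}
    (hs : IsMinOn P.f Set.univ βs) :
    ∃ m, 0 < m ∧ ∀ v : E p, ‖v‖ ≤ 1 → m * ‖v‖ ^ 2 ≤ P.f (βs + v) - P.f βs := by
  obtain ⟨κ, hκ, hκv⟩ := P.exists_sum_inner_sq_lower_bound hL
  choose c hc hcv using fun i =>
    (P.isSmoothLoss i).exists_strong_lower_bound (inner ℝ βs (P.x i)) ‖P.x i‖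
  obtain ⟨c₀, hc₀, hc₀i⟩ : ∃ c₀, 0 < c₀ ∧ ∀ i, c₀ ≤ c i := by
    rcases isEmpty_or_nonempty (Fin n) with hn | hn
    · exact ⟨1, one_pos, fun i => isEmptyElim i⟩
    · obtain ⟨i, hi⟩ := Finite.exists_min c
      exact ⟨c i, hc i, hi⟩
  refine ⟨c₀ / 2 * κ, by positivity, fun v hv => ?_⟩
  have h1 : P.L βs + inner ℝ (gradient P.L βs) v + c₀ / 2 * ∑ i, (inner ℝ (P.x i) v) ^ 2 ≤
      P.L (βs + v) := by
    rw [inner_gradient_L, L, L, Finset.mul_sum, ← Finset.sum_add_distrib,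
      ← Finset.sum_add_distrib]
    refine Finset.sum_le_sum fun i _ => ?_
    have h2 : |inner ℝ (P.x i) v| ≤ ‖P.x i‖ :=
      (abs_real_inner_le_norm _ _).trans (mul_le_of_le_one_right (norm_nonneg _) hv)
    have h3 := hcv i _ h2
    have h4 := mul_le_mul_of_nonneg_right (hc₀i i) (sq_nonneg (inner ℝ (P.x i) v))
    rw [inner_add_left, real_inner_comm (P.x i) v]
    linarith
  have h5 := P.inner_gradient_add_R_nonneg hs v
  have h6 := mul_le_mul_of_nonneg_left (hκv v) (half_pos hc₀).le
  simp only [f]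
  linarith

/-- Quadratic growth on sublevel sets. -/
lemma exists_growth (hL : StrictConvexOn ℝ Set.univ P.L) {βs : E p}
    (hs : IsMinOn P.f Set.univ βs) (F : ℝ) :
    ∃ m, 0 < m ∧ ∀ z, P.f z - P.f βs ≤ F → m * ‖z - βs‖ ^ 2 ≤ P.f z - P.f βs := by
  obtain ⟨m, hm, hmv⟩ := P.exists_local_growth hL hs
  have hρ1 : 1 ≤ max 1 (F / m) := le_max_left _ _
  set ρ := max 1 (F / m)
  have hρ0 : 0 < ρ := by linarith
  refine ⟨m / ρ, by positivity, fun z hz => ?_⟩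
  rw [div_mul_eq_mul_div, div_le_iff₀ hρ0]
  set v := z - βs with hv
  have hzv : z = βs + v := by rw [hv]; abel
  have hf0 : 0 ≤ P.f z - P.f βs := sub_nonneg.2 (hs (Set.mem_univ _))
  rcases le_or_gt ‖v‖ 1 with h1 | h1
  · have := hmv v h1
    rw [← hzv] at this
    nlinarith
  -- Outside the unit ball, growth on the unit sphere extends by convexity to linear growth `m ‖v‖`.
  -- On the sublevel set this bounds `‖v‖` by `ρ`, so linear growth implies quadratic growth with `m
  -- / ρ`.
  · have hv0 : 0 < ‖v‖ := one_pos.trans h1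
    have hn : ‖‖v‖⁻¹ • v‖ = 1 := by
      rw [norm_smul, norm_inv, norm_norm, inv_mul_cancel₀ hv0.ne']
    have h2 := hmv (‖v‖⁻¹ • v) hn.le
    have h3 := P.f_add_smul_le βs v (inv_nonneg.2 hv0.le) (inv_le_one_of_one_le₀ h1.le)
    rw [hn] at h2
    rw [← hzv] at h3
    have h4 : m ≤ ‖v‖⁻¹ * (P.f z - P.f βs) := by linarith
    have h5 : m * ‖v‖ ≤ P.f z - P.f βs := by
      rw [inv_mul_eq_div, le_div_iff₀ hv0] at h4
      exact h4
    have h6 : ‖v‖ ≤ ρ := by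
      refine le_trans ?_ (le_max_right _ _)
      rw [le_div_iff₀ hm]
      linarith
    nlinarith [mul_le_mul_of_nonneg_left h6 (mul_nonneg hm.le hv0.le)]

end Problem

end DGLMNET

theorem mainTheorem1 (n p M : ℕ) (P : DGLMNET.Problem n p M) (prm : DGLMNET.Params) :
    -- uniform bounds on `H = μ (H̃(β) + ν I)`, and the identification as CGD
    (∃ lmin lmax : ℝ, 0 < lmin ∧ 0 < lmax ∧
      ∀ μmax : ℝ,
        (∀ (μ : ℝ) (β : DGLMNET.E p), 1 ≤ μ → μ ≤ μmax →
          DGLMNET.LoewnerBounded lmin (μmax * lmax) (P.modelMatrix prm.ν μ β)) ∧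
        (∀ (μ : ℕ → ℝ) (β d : ℕ → DGLMNET.E p) (α : ℕ → ℝ),
          (∀ k, 1 ≤ μ k ∧ μ k ≤ μmax) → P.IsRun prm .exact μ β d α →
          DGLMNET.IsCGD P.L P.R lmin (μmax * lmax) prm.b prm.σ prm.γ (fun _ => Finset.univ)
            (fun k => P.modelMatrix prm.ν (μ k) (β k)) β d α)) ∧
    -- the adaptive rule keeps `μ` bounded
    (∀ η₁ η₂ : ℝ, 1 ≤ η₁ → 1 ≤ η₂ → ∃ μmax : ℝ,
      ∀ (solver : DGLMNET.SubSolver) (μ : ℕ → ℝ) (β d : ℕ → DGLMNET.E p) (α : ℕ → ℝ),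
        P.IsRun prm solver μ β d α → DGLMNET.AdaptiveRule η₁ η₂ α μ →
        ∀ k, 1 ≤ μ k ∧ μ k ≤ μmax) ∧
    -- a minimizer exists as soon as there is a penalty
    (0 < P.lam1 ∨ 0 < P.lam2 → ∃ βs, IsMinOn P.f Set.univ βs) ∧
    -- global convergence and linear rates
    (∀ (solver : DGLMNET.SubSolver), (solver = .oneCycle → prm.γ ≤ 1 / 2) →
      ∀ (μmax : ℝ) (μ : ℕ → ℝ) (β d : ℕ → DGLMNET.E p) (α : ℕ → ℝ),
        (∀ k, 1 ≤ μ k ∧ μ k ≤ μmax) → P.IsRun prm solver μ β d α →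
        (∀ βc, MapClusterPt βc Filter.atTop β → IsMinOn P.f Set.univ βc) ∧
        (∀ βs, IsMinOn P.f Set.univ βs →
          Filter.Tendsto (fun k => P.f (β k)) Filter.atTop (nhds (P.f βs)) ∧
          (StrictConvexOn ℝ Set.univ P.L →
            DGLMNET.QLinear (fun k => P.f (β k)) (P.f βs) ∧ DGLMNET.RLinear β βs))) := by
  refine ⟨⟨prm.ν, P.lip + prm.ν, prm.ν_pos, add_pos_of_nonneg_of_pos P.lip_nonneg prm.ν_pos,
    fun μmax => ⟨fun μ β h1 h2 => P.loewnerBounded_modelMatrix prm.ν_pos.le h1 h2 β,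
      fun μ β d α hμ h => h.isCGD hμ⟩⟩,
    fun η₁ η₂ h1 h2 => ⟨_, fun solver μ β d α h hμ => h.adaptive_bounds h1 h2 hμ⟩,
    P.exists_isMinOn_f, fun solver hγ μmax μ β d α hμ h => ?_⟩
  have hseq := h.isDescentSeq hγ hμ
  refine ⟨fun βc hc => hseq.isMinOn_of_mapClusterPt P.continuous_f hc,
    fun βs hs => ⟨hseq.tendsto_of_isMinOn hs, fun hL => ?_⟩⟩
  -- By descent the whole run stays in the sublevel set of `β 0`, so one growth constant serves all
  -- iterates.
  obtain ⟨m, hm, hg⟩ := P.exists_growth hL hs (P.f (β 0) - P.f βs)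
  exact hseq.qLinear_and_rLinear hs hm fun k =>
    hg _ (sub_le_sub_right (hseq.antitone (Nat.zero_le k)) _)
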